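/- All manifolds, bundles, sections and functions are smooth and real; $M$ is a finite-dimensional manifold without boundary, $A\to M$ is a vector bundle of finite rank and $A^*$ is its dual bundle. **Generalized Lie bialgebroids.** Let $([\,,],a)$ be a Lie algebroid structure on $A$, with differential $d$, and $([\,,]_*,a_*)$ a Lie algebroid structure on $A^*$, with differential $d_*$ (acting on sections of $\bigwedge A$). Let $\phi\in\Gamma(A^*)$ be a $1$-cocycle of $A$, i.e. $\langle\phi,[X,Y]\rangle=a(X)\langle\phi,Y\rangle-a(Y)\langle\phi,X\rangle$, and let $W\in\Gamma(A)$ be a $1$-cocycle of $A^*$. Put $d^\phi\eta=d\eta+\phi\wedge\eta$ and $\mathcal L^\phi_X=d^\phi\circ i_X+i_X\circ d^\phi$ on forms of $A$ (sections of $\bigwedge A^*$), and define $d_*^W$ and $\mathcal L^W_{*\alpha}$ in the same way from $A^*$ and $W$. For $X\in\Gamma(A)$ and $Q\in\Gamma(\bigwedge^qA)$ let $[X,Q]^\phi=[X,Q]-(q-1)\langle\phi,X\rangle Q$, where $[X,Q]$ is the Schouten bracket (the Lie derivative of $Q$ along $X$); put $\mathcal L^\phi_XQ=[X,Q]^\phi$,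 and $[P,X]^\phi=-[X,P]^\phi$ for $P\in\Gamma(\bigwedge^2A)$. Assume that $((A,\phi),(A^*,W))$ is a generalized Lie bialgebroid, i.e. for all $X,Y\in\Gamma(A)$, all $p\ge0$ and all $Q\in\Gamma(\bigwedge^pA)$, $$d_*^W[X,Y]=[d_*^WX,Y]^\phi+[X,d_*^WY]^\phi,\qquad \mathcal L^W_{*\phi}Q+\mathcal L^\phi_WQ=0 .$$ **The generalized Courant algebroid $(A\oplus A^*,\phi+W)$.** On $A\oplus A^*$ put $(X_1+\alpha_1,X_2+\alpha_2)_\pm=\tfrac12(\langle\alpha_1,X_2\rangle\pm\langle\alpha_2,X_1\rangle)$, and for sections $e_i=X_i+\alpha_i$ of $A\oplus A^*$ put $$[\![e_1,e_2]\!]=\big([X_1,X_2]+\mathcal L^W_{*\alpha_1}X_2-\mathcal L^W_{*\alpha_2}X_1-d_*^W(e_1,e_2)_-\big)+\big([\alpha_1,\alpha_2]_*+\mathcal L^\phi_{X_1}\alpha_2-\mathcal L^\phi_{X_2}\alpha_1+d^\phi(e_1,e_2)_-\big).$$ **The Courant algebroid $\tilde A\oplus\tilde A^*$ over $M\times\mathbb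 R$.** Let $\tilde A=A\times\mathbb R$ and $\tilde A^*=A^*\times\mathbb R$, vector bundles over $M\times\mathbb R$; their sections are the time-dependent sections $X(x,t)=X_t(x)$ of $A$ and of $A^*$, and $[X,Y]^{\sim}(x,t)=[X_t,Y_t](x)$, similarly $[\,,]_*^{\sim}$. Equip $\tilde A$ with $$[X,Y]^{\sim\phi}=[X,Y]^{\sim}+\langle\phi,X\rangle\tfrac{\partial Y}{\partial t}-\langle\phi,Y\rangle\tfrac{\partial X}{\partial t},\qquad \tilde a^\phi(X)=a(X)+\langle\phi,X\rangle\tfrac{\partial}{\partial t},$$ and $\tilde A^*$ with $$[\alpha,\beta]_*^{\wedge W}=e^{-t}\Big([\alpha,\beta]_*^{\sim}+\langle\alpha,W\rangle\big(\tfrac{\partial\beta}{\partial t}-\beta\big)-\langle\beta,W\rangle\big(\tfrac{\partial\alpha}{\partial t}-\alpha\big)\Big),\qquad \hat a_*^W(\alpha)=e^{-t}\big(a_*(\alpha)+\langle\alpha,W\rangle\tfrac{\partial}{\partial t}\big).$$ On $\tilde A\oplus\tilde A^*$ define $(\,,)_\pm$ by the same formulas as above, and define $[\![\,,]\!]^{\sim}$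 by the same formula as $[\![\,,]\!]$, with the brackets, Lie derivatives and differentials replaced by those of the two structures just defined, and with zero cocycles. **Dirac structures.** A Dirac structure for one of these is a vector subbundle whose fibres are maximal isotropic for $(\,,)_+$ and whose space of sections is closed under $[\![\,,]\!]$ (respectively $[\![\,,]\!]^{\sim}$). **Claim.** Let $L$ be a vector subbundle of $A\oplus A^*$, and let $\tilde L\subset\tilde A\oplus\tilde A^*$ have the fibres $\tilde L_{(x,t)}=\{X+e^t\alpha : X+\alpha\in L_x\}$. Then $L$ is a Dirac structure for the generalized Courant algebroid $(A\oplus A^*,\phi+W)$ if and only if $\tilde L$ is a Dirac structure for the Courant algebroid $\tilde A\oplus\tilde A^*$. -/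

import Mathlib

open Bundle
open scoped Manifold ContDiff Topology

set_option linter.unusedSectionVars false

noncomputable section

namespace DiracCourant

section Basic

variable {E : Type*} [NormedAddCommGroup E] [NormedSpace ℝ E] {H : Type*} [TopologicalSpace H]
  (I : ModelWithCorners ℝ E H) {M : Type*} [TopologicalSpace M] [ChartedSpace H M]
  (F : Type*) [NormedAddCommGroup F] [NormedSpace ℝ F]
  (V : M → Type*) [TopologicalSpace (TotalSpace F V)] [∀ x, AddCommGroup (V x)]
  [∀ x, Module ℝ (V x)] [∀ x, TopologicalSpace (V x)] [FiberBundle F V] [VectorBundle ℝ F V]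
  (F' : Type*) [NormedAddCommGroup F'] [NormedSpace ℝ F']
  (V' : M → Type*) [TopologicalSpace (TotalSpace F' V')] [∀ x, AddCommGroup (V' x)]
  [∀ x, Module ℝ (V' x)] [∀ x, TopologicalSpace (V' x)] [FiberBundle F' V'] [VectorBundle ℝ F' V']

/-- Smooth sections of the vector bundle `V` with typical fibre `F`. -/
abbrev Sec := ContMDiffSection I F ∞ V

/-- Smooth real functions on `M`. -/
abbrev Fn (M : Type*) [TopologicalSpace M] [ChartedSpace H M] := ContMDiffMap I 𝓘(ℝ, ℝ) M ℝ ∞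

/-- The module structure of the sections over the smooth functions. -/
instance secModule : Module (Fn I M) (Sec I F V) where
  smul f X := ⟨fun x => f x • X x, f.contMDiff.smul_section X.contMDiff⟩
  one_smul X := ContMDiffSection.ext fun x => one_smul ℝ (X x)
  mul_smul f g X := ContMDiffSection.ext fun x => mul_smul (f x) (g x) (X x)
  smul_zero f := ContMDiffSection.ext fun x => smul_zero (f x)
  smul_add f X Y := ContMDiffSection.ext fun x => smul_add (f x) (X x) (Y x)
  add_smul f g X := ContMDiffSection.ext fun x => add_smul (f x) (g x) (X x)
  zero_smul X := ContMDiffSection.ext fun x => zero_smul ℝ (X x)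

variable {I F V F' V'}

lemma fsmul_apply (f : Fn I M) (X : Sec I F V) (x : M) : (f • X) x = f x • X x := rfl

variable [IsManifold I ∞ M]

/-- The derivative of the function `f` at `x` along the tangent vector `v`. -/
def dir (f : M → ℝ) (x : M) (v : TangentSpace I x) : ℝ := mfderiv I 𝓘(ℝ, ℝ) f x v

lemma contMDiff_dir {EN HN N : Type*} [NormedAddCommGroup EN]
    [NormedSpace ℝ EN] [TopologicalSpace HN] {J : ModelWithCorners ℝ EN HN} [TopologicalSpace N]
    [ChartedSpace HN N] (f : Fn I M) {g : N → M} {v : ∀ y, TangentSpace I (g y)}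
    (h : ContMDiff J I.tangent ∞ (fun y => (⟨g y, v y⟩ : TangentBundle I M))) :
    ContMDiff J 𝓘(ℝ, ℝ) ∞ fun y => dir f (g y) (v y) := by
  have : IsManifold I 1 M := .of_le (n := ∞) (by simp)
  have h1 : ContMDiff I.tangent 𝓘(ℝ, ℝ).tangent ∞ (tangentMap I 𝓘(ℝ, ℝ) f) :=
    f.contMDiff.contMDiff_tangentMap (by simp)
  exact (contMDiff_snd_tangentBundle_modelSpace (𝕜 := ℝ) ℝ 𝓘(ℝ, ℝ)).comp (h1.comp h)

variable (I F V) in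
/-- A vector bundle with an anchor to the tangent bundle and a skew-symmetric real bilinear
bracket of sections that satisfies the Leibniz rule: a Lie algebroid without the Jacobi
identity. -/
structure SkewAlgebroid where
  anchor : ∀ x, V x →ₗ[ℝ] TangentSpace I x
  smooth_anchor : ∀ X : Sec I F V,
    ContMDiff I I.tangent ∞ (fun x => (⟨x, anchor x (X x)⟩ : TangentBundle I M))
  bracket : Sec I F V → Sec I F V → Sec I F V
  bracket_add : ∀ X Y Z, bracket X (Y + Z) = bracket X Y + bracket X Z
  bracket_smul : ∀ (c : ℝ) (X Y), bracket X (c • Y) = c • bracket X Y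
  bracket_skew : ∀ X Y, bracket X Y = -bracket Y X
  leibniz : ∀ (X Y) (f : Fn I M) (x : M), bracket X (f • Y) x =
    f x • bracket X Y x + dir f x (anchor x (X x)) • Y x

/-- The function `a(X) f`. -/
def SkewAlgebroid.act (𝒜 : SkewAlgebroid I F V) (X : Sec I F V) (f : Fn I M) :
    Fn I M :=
  ⟨fun x => dir f x (𝒜.anchor x (X x)),
    contMDiff_dir f (𝒜.smooth_anchor X)⟩

variable (I F V) in
/-- Lie algebroids. -/
structure LieAlgebroid extends SkewAlgebroid I F V where
  jacobi : ∀ X Y Z, bracket X (bracket Y Z) + bracket Y (bracket Z X) +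
    bracket Z (bracket X Y) = 0
  anchor_bracket : ∀ (X Y) (f : Fn I M), toSkewAlgebroid.act (bracket X Y) f =
    toSkewAlgebroid.act X (toSkewAlgebroid.act Y f) -
      toSkewAlgebroid.act Y (toSkewAlgebroid.act X f)

variable (I F V F' V') in
/-- A fibrewise bilinear pairing that exhibits `V` and `V'` as dual vector bundles: it is smooth,
and near each point there are smooth sections `e i` of `V` and `ε i` of `V'` with
`v = ∑ i, ⟨v, ε i⟩ e i` and `w = ∑ i, ⟨e i, w⟩ ε i` (in particular it is nondegenerate). -/
structure DualPair where
  pair : ∀ x, V x →ₗ[ℝ] V' x →ₗ[ℝ] ℝ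
  smooth : ∀ (X : Sec I F V) (β : Sec I F' V'),
    ContMDiff I 𝓘(ℝ, ℝ) ∞ fun x => pair x (X x) (β x)
  frame : ∀ x₀, ∃ (n : ℕ) (e : Fin n → Sec I F V) (ε : Fin n → Sec I F' V'), ∀ᶠ x in 𝓝 x₀,
    (∀ v, v = ∑ i, pair x v (ε i x) • e i x) ∧ ∀ w, w = ∑ i, pair x (e i x) w • ε i x

/-- Exchange of the two bundles of a dual pair. -/
def DualPair.swap (P : DualPair I F V F' V') : DualPair I F' V' F V where
  pair x := (P.pair x).flip
  smooth β X := P.smooth X β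
  frame x₀ := by
    obtain ⟨n, e, ε, h⟩ := P.frame x₀
    exact ⟨n, ε, e, h.mono fun x hx => ⟨hx.2, hx.1⟩⟩

/-- The smooth function `⟨X, β⟩`. -/
def DualPair.fn (P : DualPair I F V F' V') (X : Sec I F V) (β : Sec I F' V') : Fn I M :=
  ⟨fun x => P.pair x (X x) (β x), P.smooth X β⟩

lemma DualPair.ext_left (P : DualPair I F V F' V') {x : M} {v v' : V x}
    (h : ∀ w, P.pair x v w = P.pair x v' w) : v = v' := by
  obtain ⟨n, e, ε, hf⟩ := P.frame x
  have := hf.self_of_nhds.1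
  rw [this v, this v']
  simp [h]

/-- Smoothness of a section of `V` can be tested by pairing it with the sections of `V'`. -/
lemma DualPair.contMDiff_of_pair (P : DualPair I F V F' V') (s : ∀ x, V x)
    (h : ∀ β : Sec I F' V', ContMDiff I 𝓘(ℝ, ℝ) ∞ fun x => P.pair x (s x) (β x)) :
    ContMDiff I (I.prod 𝓘(ℝ, F)) ∞ (fun x => TotalSpace.mk' F x (s x)) := by
  intro x₀
  obtain ⟨n, e, ε, hf⟩ := P.frame x₀
  have h1 : ContMDiffAt I (I.prod 𝓘(ℝ, F)) ∞ (fun x => TotalSpace.mk' F x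
      (∑ i, P.pair x (s x) (ε i x) • e i x)) x₀ :=
    ContMDiffAt.sum_section fun i _ => ((h (ε i)).smul_section (e i).contMDiff) x₀
  refine h1.congr_of_eventuallyEq (hf.mono fun x hx => ?_)
  exact congrArg (TotalSpace.mk' F x) (hx.1 (s x))

variable [FiniteDimensional ℝ E] [T2Space M]

lemma exists_cutoff {x₀ : M} {p : M → Prop} (h : ∀ᶠ x in 𝓝 x₀, p x) :
    ∃ g : Fn I M, g x₀ = 0 ∧ ∀ x, p x ∨ g x = 1 := by
  obtain ⟨ρ, -, hρ⟩ := (SmoothBumpFunction.nhds_basis_tsupport (I := I) x₀).mem_iff.1 h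
  refine ⟨⟨fun x => 1 - ρ x, contMDiff_const.sub ρ.contMDiff⟩, by simp, fun x => ?_⟩
  by_cases hx : x ∈ tsupport ρ
  · exact .inl (hρ hx)
  · right
    simp [image_eq_zero_of_notMem_tsupport hx]

/-- The section of `V'` that represents a tensorial form on the sections of `V`. -/
lemma DualPair.exists_rep (P : DualPair I F V F' V') (T : Sec I F V →ₗ[Fn I M] Fn I M) :
    ∃ β : Sec I F' V', ∀ X, P.fn X β = T X := by
  have loc : ∀ (X : Sec I F V) (x : M), (∀ᶠ y in 𝓝 x, X y = 0) → T X x = 0 := by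
    intro X x h
    obtain ⟨g, hg, hp⟩ := exists_cutoff (I := I) h
    have : X = g • X := by
      ext y
      rw [fsmul_apply]
      rcases hp y with h | h <;> simp [h]
    rw [this, map_smul]
    show g x * T X x = 0
    rw [hg, zero_mul]
  choose n e ε hf using P.frame
  let b : ∀ x, V' x := fun x => ∑ i, (T (e x i) x) • ε x i x
  have hb : ∀ (X : Sec I F V) (x : M), P.pair x (X x) (b x) = T X x := by
    intro X x
    have h0 : T (X - ∑ i, P.fn X (ε x i) • e x i) x = 0 := by
      apply loc
      filter_upwards [hf x] with y hy
      have h1 : (∑ i, P.fn X (ε x i) • e x i : Sec I F V) y =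
          ∑ i, P.pair y (X y) (ε x i y) • e x i y := by
        rw [← ContMDiffSection.coeAddHom_apply, map_sum, Finset.sum_apply]
        rfl
      rw [ContMDiffSection.coe_sub, Pi.sub_apply, h1, ← hy.1 (X y), sub_self]
    rw [map_sub, map_sum] at h0
    have h2 : T X x = (∑ i, T (P.fn X (ε x i) • e x i) : Fn I M) x := sub_eq_zero.1 h0
    have h3 : (∑ i, T (P.fn X (ε x i) • e x i) : Fn I M) x =
        ∑ i, (T (P.fn X (ε x i) • e x i)) x := by
      have := map_sum (ContMDiffMap.evalRingHom (I := I) (n := ∞) (R := ℝ) x)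
        (fun i => T (P.fn X (ε x i) • e x i)) Finset.univ
      exact this
    rw [h2, h3]
    simp only [b, map_sum, map_smul, smul_eq_mul]
    refine Finset.sum_congr rfl fun i _ => ?_
    show _ = P.pair x (X x) (ε x i x) * _
    rw [mul_comm]
  refine ⟨⟨b, P.swap.contMDiff_of_pair b fun X => ?_⟩, fun X => ContMDiffMap.ext fun x => hb X x⟩
  have : (fun x => P.swap.pair x (b x) (X x)) = T X := funext fun x => hb X x
  rw [this]
  exact (T X).contMDiff

/-- The section of `V'` that represents a tensorial form on the sections of `V`. -/
def DualPair.rep (P : DualPair I F V F' V') (T : Sec I F V →ₗ[Fn I M] Fn I M) : Sec I F' V' :=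
  (P.exists_rep T).choose

lemma DualPair.fn_rep (P : DualPair I F V F' V') (T : Sec I F V →ₗ[Fn I M] Fn I M)
    (X : Sec I F V) : P.fn X (P.rep T) = T X :=
  (P.exists_rep T).choose_spec X

lemma dir_add_right (f : M → ℝ) (x : M) (v w : TangentSpace I x) :
    dir f x (v + w) = dir f x v + dir f x w := map_add (mfderiv I 𝓘(ℝ, ℝ) f x) v w

lemma dir_smul_right (f : M → ℝ) (x : M) (c : ℝ) (v : TangentSpace I x) :
    dir f x (c • v) = c * dir f x v := map_smul (mfderiv I 𝓘(ℝ, ℝ) f x) c v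

lemma dir_mul (f g : Fn I M) (x : M) (v : TangentSpace I x) :
    dir (f * g : Fn I M) x v = f x * dir g x v + dir f x v * g x := by
  have hf : MDifferentiableAt I 𝓘(ℝ, ℝ) f x := f.mdifferentiableAt
  have hg : MDifferentiableAt I 𝓘(ℝ, ℝ) g x := g.mdifferentiableAt
  have := congrArg (fun T => (T v : ℝ)) (hf.hasMFDerivAt.mul hg.hasMFDerivAt).mfderiv
  refine this.trans ?_
  show f x * dir g x v + g x * dir f x v = _
  ring

lemma dir_add (f g : Fn I M) (x : M) (v : TangentSpace I x) :
    dir (f + g : Fn I M) x v = dir f x v + dir g x v := by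
  have hf : MDifferentiableAt I 𝓘(ℝ, ℝ) f x := f.mdifferentiableAt
  have hg : MDifferentiableAt I 𝓘(ℝ, ℝ) g x := g.mdifferentiableAt
  exact congrArg (fun T => (T v : ℝ)) (hf.hasMFDerivAt.add hg.hasMFDerivAt).mfderiv

namespace SkewAlgebroid

variable (𝒜 : SkewAlgebroid I F V)

lemma act_add_left (X Y : Sec I F V) (f : Fn I M) :
    𝒜.act (X + Y) f = 𝒜.act X f + 𝒜.act Y f := by
  ext x
  show dir f x (𝒜.anchor x (X x + Y x)) = _
  rw [map_add, dir_add_right]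
  rfl

lemma act_smul_left (g : Fn I M) (X : Sec I F V) (f : Fn I M) :
    𝒜.act (g • X) f = g * 𝒜.act X f := by
  ext x
  show dir f x (𝒜.anchor x (g x • X x)) = _
  rw [map_smul, dir_smul_right]
  rfl

lemma act_add (X : Sec I F V) (f g : Fn I M) : 𝒜.act X (f + g) = 𝒜.act X f + 𝒜.act X g :=
  ContMDiffMap.ext fun x => dir_add f g x _

lemma act_mul (X : Sec I F V) (f g : Fn I M) :
    𝒜.act X (f * g) = f * 𝒜.act X g + 𝒜.act X f * g :=
  ContMDiffMap.ext fun x => dir_mul f g x _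

lemma bracket_fsmul (X Y : Sec I F V) (f : Fn I M) :
    𝒜.bracket X (f • Y) = f • 𝒜.bracket X Y + 𝒜.act X f • Y :=
  ContMDiffSection.ext fun x => 𝒜.leibniz X Y f x

lemma add_bracket (X Y Z : Sec I F V) :
    𝒜.bracket (X + Y) Z = 𝒜.bracket X Z + 𝒜.bracket Y Z := by
  rw [bracket_skew, bracket_add, neg_add, ← bracket_skew, ← bracket_skew]

lemma fsmul_bracket (X Y : Sec I F V) (f : Fn I M) :
    𝒜.bracket (f • X) Y = f • 𝒜.bracket X Y - 𝒜.act Y f • X := by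
  rw [bracket_skew, bracket_fsmul, 𝒜.bracket_skew Y X, neg_add, smul_neg, neg_neg, sub_eq_add_neg]

variable (I F V) in
/-- Functions of `p` sections with values in the smooth functions; the `p`-forms are those that are
alternating and linear over the smooth functions. -/
abbrev Cochain (p : ℕ) := (Fin p → Sec I F V) → Fn I M

/-- The differential `d`, by the Koszul formula. In the second sum `(i, j.succ)` runs through the
pairs of indices `i < j.succ`. -/
def d : ∀ {p : ℕ}, Cochain I F V p → Cochain I F V (p + 1)
  | 0, η => fun X => 𝒜.act (X 0) (η Fin.elim0)
  | p + 1, η => fun X =>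
      ∑ i : Fin (p + 2), (-1 : Fn I M) ^ (i : ℕ) * 𝒜.act (X i) (η (i.removeNth X)) +
      ∑ i : Fin (p + 2), ∑ j : Fin (p + 1), if i ≤ j.castSucc then
        (-1 : Fn I M) ^ ((i : ℕ) + j.succ) *
          η (Fin.cons (𝒜.bracket (X i) (X j.succ)) (j.removeNth (i.removeNth X))) else 0

/-- The differential `d^φ η = d η + φ ∧ η` twisted by the `1`-form `φ`. -/
def dTwist (φ : Sec I F V → Fn I M) {p : ℕ} (η : Cochain I F V p) : Cochain I F V (p + 1) :=
  fun X => 𝒜.d η X + ∑ i : Fin (p + 1), (-1 : Fn I M) ^ (i : ℕ) * φ (X i) * η (i.removeNth X)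

/-- The contraction `i_X`. -/
def contract {p : ℕ} (X : Sec I F V) (η : Cochain I F V (p + 1)) : Cochain I F V p :=
  fun Y => η (Fin.cons X Y)

/-- The twisted Lie derivative `d^φ ∘ i_X + i_X ∘ d^φ` (where `i_X` vanishes on functions). -/
def lieTwist (φ : Sec I F V → Fn I M) (X : Sec I F V) :
    ∀ {p : ℕ}, Cochain I F V p → Cochain I F V p
  | 0, η => contract X (𝒜.dTwist φ η)
  | _ + 1, η => 𝒜.dTwist φ (contract X η) + contract X (𝒜.dTwist φ η)

/-- `φ` is a `1`-cocycle. -/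
def IsCocycle (φ : Sec I F V → Fn I M) : Prop :=
  ∀ X Y, φ (𝒜.bracket X Y) = 𝒜.act X (φ Y) - 𝒜.act Y (φ X)

end SkewAlgebroid

namespace DualPair

variable (P : DualPair I F V F' V')

/-- The `1`-form on `V` given by a section of `V'`. -/
def form (β : Sec I F' V') : SkewAlgebroid.Cochain I F V 1 := fun X => P.fn (X 0) β

lemma fn_add_left (X Y : Sec I F V) (β : Sec I F' V') : P.fn (X + Y) β = P.fn X β + P.fn Y β := by
  ext x
  show P.pair x (X x + Y x) (β x) = _
  rw [map_add]
  rfl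

lemma fn_smul_left (f : Fn I M) (X : Sec I F V) (β : Sec I F' V') :
    P.fn (f • X) β = f * P.fn X β := by
  ext x
  show P.pair x (f x • X x) (β x) = _
  rw [map_smul]
  rfl

lemma fn_neg_left (X : Sec I F V) (β : Sec I F' V') : P.fn (-X) β = -P.fn X β := by
  ext x
  show P.pair x (-X x) (β x) = _
  rw [map_neg]
  rfl

lemma fn_sub_left (X Y : Sec I F V) (β : Sec I F' V') : P.fn (X - Y) β = P.fn X β - P.fn Y β := by
  rw [sub_eq_add_neg, fn_add_left, fn_neg_left, sub_eq_add_neg]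

variable (𝒜 : SkewAlgebroid I F V)

lemma dTwist_fn (φ : Sec I F' V') (f : Fn I M) (Y : Sec I F V) :
    𝒜.dTwist (P.fn · φ) (p := 0) (fun _ => f) ![Y] = 𝒜.act Y f + P.fn Y φ * f := by
  simp [SkewAlgebroid.dTwist, SkewAlgebroid.d]

lemma lieTwist_form (φ : Sec I F' V') (X : Sec I F V) (β : Sec I F' V') (Y : Sec I F V) :
    𝒜.lieTwist (P.fn · φ) X (P.form β) ![Y] =
      𝒜.act X (P.fn Y β) - P.fn (𝒜.bracket X Y) β + P.fn X φ * P.fn Y β := by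
  simp [SkewAlgebroid.lieTwist, SkewAlgebroid.dTwist, SkewAlgebroid.d, SkewAlgebroid.contract,
    form, Fin.sum_univ_two, Fin.removeNth]
  ring

/-- The section `d^φ f` of `V'`. -/
def dFn (φ : Sec I F' V') (f : Fn I M) : Sec I F' V' :=
  P.rep
    { toFun := fun Y => 𝒜.dTwist (P.fn · φ) (p := 0) (fun _ => f) ![Y]
      map_add' := fun Y Z => by
        simp only [dTwist_fn, fn_add_left, SkewAlgebroid.act_add_left]
        ring
      map_smul' := fun g Y => by
        simp only [dTwist_fn, fn_smul_left, SkewAlgebroid.act_smul_left, RingHom.id_apply,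
          smul_eq_mul]
        ring }

/-- The Lie derivative `ℒ_X^φ β = (d^φ ∘ i_X + i_X ∘ d^φ) β` as a section of `V'`. -/
def lie (φ : Sec I F' V') (X : Sec I F V) (β : Sec I F' V') : Sec I F' V' :=
  P.rep
    { toFun := fun Y => 𝒜.lieTwist (P.fn · φ) X (P.form β) ![Y]
      map_add' := fun Y Z => by
        simp only [lieTwist_form, fn_add_left, SkewAlgebroid.act_add, SkewAlgebroid.bracket_add]
        ring
      map_smul' := fun g Y => by
        simp only [lieTwist_form, fn_smul_left, SkewAlgebroid.bracket_fsmul, fn_add_left,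
          SkewAlgebroid.act_mul, RingHom.id_apply, smul_eq_mul]
        ring }

/-- The bracket `[X, Q]^φ = ℒ_X Q - (q - 1) ⟨φ, X⟩ Q` of a section `X` of `V` and a `q`-vector field
`Q` of `V`, the latter being regarded as an alternating form on the sections of `V'`. -/
def schouten (φ : Sec I F' V') (X : Sec I F V) {q : ℕ} (Q : SkewAlgebroid.Cochain I F' V' q) :
    SkewAlgebroid.Cochain I F' V' q :=
  fun β => 𝒜.act X (Q β) - ∑ i, Q (Function.update β i (P.lie 𝒜 0 X (β i))) -
    ((q : Fn I M) - 1) * P.fn X φ * Q β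

variable (ℬ : SkewAlgebroid I F' V')

/-- The compatibility conditions of a generalized Lie bialgebroid: for sections `X`, `Y` of `V`,
`d_*^W [X, Y] = [d_*^W X, Y]^φ + [X, d_*^W Y]^φ`, where `[P, Y]^φ = -[Y, P]^φ` for the `2`-vector
field `P = d_*^W X`; and `ℒ_{*φ}^W Q + ℒ_W^φ Q = 0` for every `p`-vector field `Q` of `V`, where
`ℒ_W^φ Q = [W, Q]^φ`. -/
structure IsGenLieBialgebroid (φ : Sec I F' V') (W : Sec I F V) : Prop where
  cocycle : 𝒜.IsCocycle (P.fn · φ)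
  cocycle_dual : ℬ.IsCocycle (P.swap.fn · W)
  d_bracket : ∀ X Y : Sec I F V,
    ℬ.dTwist (P.swap.fn · W) (P.swap.form (𝒜.bracket X Y)) =
      -P.schouten 𝒜 φ Y (ℬ.dTwist (P.swap.fn · W) (P.swap.form X)) +
        P.schouten 𝒜 φ X (ℬ.dTwist (P.swap.fn · W) (P.swap.form Y))
  lie_add_lie : ∀ (p : ℕ) (Q : Sec I F' V' [⋀^Fin p]→ₗ[Fn I M] Fn I M),
    ℬ.lieTwist (P.swap.fn · W) φ Q + P.schouten 𝒜 φ W Q = 0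

/-- The pairing `(X₁ + α₁, X₂ + α₂)₊ = (⟨α₁, X₂⟩ + ⟨α₂, X₁⟩) / 2` on the fibres of `V ⊕ V'`. -/
def formPlus (x : M) (e₁ e₂ : V x × V' x) : ℝ :=
  1 / 2 * (P.pair x e₂.1 e₁.2 + P.pair x e₁.1 e₂.2)

/-- The function `(X₁ + α₁, X₂ + α₂)₋ = (⟨α₁, X₂⟩ - ⟨α₂, X₁⟩) / 2`. -/
def formMinus (e₁ e₂ : Sec I F V × Sec I F' V') : Fn I M :=
  (1 / 2 : ℝ) • (P.fn e₂.1 e₁.2 - P.fn e₁.1 e₂.2)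

/-- The bracket on the sections of `V ⊕ V'`, which are pairs of sections of `V` and `V'`. On sections
of `V` the bracket `[ , ]^φ` is `[ , ]`, and similarly for `V'`. -/
def courantBracket (φ : Sec I F' V') (W : Sec I F V) (e₁ e₂ : Sec I F V × Sec I F' V') :
    Sec I F V × Sec I F' V' :=
  (𝒜.bracket e₁.1 e₂.1 + P.swap.lie ℬ W e₁.2 e₂.1 - P.swap.lie ℬ W e₂.2 e₁.1 -
      P.swap.dFn ℬ W (P.formMinus e₁ e₂),
    ℬ.bracket e₁.2 e₂.2 + P.lie 𝒜 φ e₁.1 e₂.2 - P.lie 𝒜 φ e₂.1 e₁.2 +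
      P.dFn 𝒜 φ (P.formMinus e₁ e₂))

variable (I F V F' V') in
/-- `L` is a smooth vector subbundle of `V ⊕ V'`: locally it has a smooth frame. -/
def IsSubbundle (L : ∀ x, Submodule ℝ (V x × V' x)) : Prop :=
  ∀ x₀, ∃ U ∈ 𝓝 x₀, ∃ (k : ℕ) (s : Fin k → ∀ x, V x × V' x),
    (∀ i, ContMDiffOn I (I.prod 𝓘(ℝ, F × F')) ∞
      (fun x => TotalSpace.mk' (F × F') (E := V ×ᵇ V') x (s i x)) U) ∧
    ∀ x ∈ U, LinearIndependent ℝ (fun i => s i x) ∧ Submodule.span ℝ (Set.range fun i => s i x) = L x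

/-- The subspace `N` of the fibre of `V ⊕ V'` is isotropic for `( , )₊`. -/
def IsIsotropic (x : M) (N : Submodule ℝ (V x × V' x)) : Prop :=
  ∀ e₁ ∈ N, ∀ e₂ ∈ N, P.formPlus x e₁ e₂ = 0

/-- The pair of sections `e` is a section of `L`. -/
def IsSection (L : ∀ x, Submodule ℝ (V x × V' x)) (e : Sec I F V × Sec I F' V') : Prop :=
  ∀ x, (e.1 x, e.2 x) ∈ L x

/-- `L` is a Dirac structure of `V ⊕ V'` with the bracket `courantBracket`: a vector subbundle that
is maximal isotropic for `( , )₊` and whose sections are closed under the bracket. -/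
structure IsDirac (φ : Sec I F' V') (W : Sec I F V) (L : ∀ x, Submodule ℝ (V x × V' x)) :
    Prop where
  isSubbundle : IsSubbundle I F V F' V' L
  isotropic : ∀ x, P.IsIsotropic x (L x)
  maximal : ∀ x, ∀ N : Submodule ℝ (V x × V' x), P.IsIsotropic x N → L x ≤ N → N = L x
  integrable : ∀ e₁ e₂ : Sec I F V × Sec I F' V', IsSection L e₁ → IsSection L e₂ →
    IsSection L (P.courantBracket 𝒜 ℬ φ W e₁ e₂)

end DualPair


end Basic
section Time

variable {E : Type*} [NormedAddCommGroup E] [NormedSpace ℝ E] {H : Type*} [TopologicalSpace H]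
  {I : ModelWithCorners ℝ E H} {M : Type*} [TopologicalSpace M] [ChartedSpace H M]

/-- The bundle `V × ℝ → M × ℝ`, that is, the pullback of `V` by the projection `M × ℝ → M`. -/
def Tilde (V : M → Type*) : M × ℝ → Type _ := fun p => V p.1

variable
  {F : Type*} [NormedAddCommGroup F] [NormedSpace ℝ F]
  {V : M → Type*} [TopologicalSpace (TotalSpace F V)] [∀ x, AddCommGroup (V x)]
  [∀ x, Module ℝ (V x)] [∀ x, TopologicalSpace (V x)] [FiberBundle F V] [VectorBundle ℝ F V]
  {F' : Type*} [NormedAddCommGroup F'] [NormedSpace ℝ F']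
  {V' : M → Type*} [TopologicalSpace (TotalSpace F' V')] [∀ x, AddCommGroup (V' x)]
  [∀ x, Module ℝ (V' x)] [∀ x, TopologicalSpace (V' x)] [FiberBundle F' V'] [VectorBundle ℝ F' V']

instance (p : M × ℝ) : AddCommGroup (Tilde V p) := inferInstanceAs (AddCommGroup (V p.1))
instance (p : M × ℝ) : Module ℝ (Tilde V p) := inferInstanceAs (Module ℝ (V p.1))
instance (p : M × ℝ) : TopologicalSpace (Tilde V p) := inferInstanceAs (TopologicalSpace (V p.1))
instance : TopologicalSpace (TotalSpace F (Tilde V)) :=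
  inferInstanceAs (TopologicalSpace
    (TotalSpace F (((ContinuousMap.fst : C(M × ℝ, M)) : M × ℝ → M) *ᵖ V)))
instance : FiberBundle F (Tilde V) :=
  inferInstanceAs (FiberBundle F (((ContinuousMap.fst : C(M × ℝ, M)) : M × ℝ → M) *ᵖ V))
instance : VectorBundle ℝ F (Tilde V) :=
  inferInstanceAs (VectorBundle ℝ F (((ContinuousMap.fst : C(M × ℝ, M)) : M × ℝ → M) *ᵖ V))

lemma contMDiff_tilde_iff (s : ∀ p : M × ℝ, V p.1) :
    ContMDiff (I.prod 𝓘(ℝ, ℝ)) ((I.prod 𝓘(ℝ, ℝ)).prod 𝓘(ℝ, F)) ∞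
      (fun p => TotalSpace.mk' F (E := Tilde V) p (s p)) ↔
    ContMDiff (I.prod 𝓘(ℝ, ℝ)) (I.prod 𝓘(ℝ, F)) ∞
      (fun p : M × ℝ => TotalSpace.mk' F (E := V) p.1 (s p)) := by
  refine forall_congr' fun p => ?_
  exact (contMDiffAt_section (E := Tilde V) (s := s) p).trans
    ⟨fun h => contMDiffAt_totalSpace.2 ⟨contMDiffAt_fst, h⟩,
      fun h => (contMDiffAt_totalSpace.1 h).2⟩

/-- Time-independent sections. -/
def pull (X : Sec I F V) : Sec (I.prod 𝓘(ℝ, ℝ)) F (Tilde V) :=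
  ⟨fun p => X p.1, (contMDiff_tilde_iff fun p => X p.1).2 (X.contMDiff.comp contMDiff_fst)⟩

/-- The section `X_t = X(·, t)`. -/
def slice (X : Sec (I.prod 𝓘(ℝ, ℝ)) F (Tilde V)) (t : ℝ) : Sec I F V :=
  ⟨fun x => X (x, t), ((contMDiff_tilde_iff fun p => X p).1 X.contMDiff).comp
    (contMDiff_id.prodMk contMDiff_const)⟩

/-- The function `f(·, t)`. -/
def sliceFn (f : Fn (I.prod 𝓘(ℝ, ℝ)) (M × ℝ)) (t : ℝ) : Fn I M :=
  ⟨fun x => f (x, t), f.contMDiff.comp (contMDiff_id.prodMk contMDiff_const)⟩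

variable [IsManifold I ∞ M]

lemma contMDiff_vectorField {v : ∀ p : M × ℝ, TangentSpace I p.1}
    (hv : ContMDiff (I.prod 𝓘(ℝ, ℝ)) I.tangent ∞ (fun p => (⟨p.1, v p⟩ : TangentBundle I M)))
    (c : Fn (I.prod 𝓘(ℝ, ℝ)) (M × ℝ)) :
    ContMDiff (I.prod 𝓘(ℝ, ℝ)) (I.prod 𝓘(ℝ, ℝ)).tangent ∞
      (fun p => (⟨p, (v p, c p)⟩ : TangentBundle (I.prod 𝓘(ℝ, ℝ)) (M × ℝ))) := by
  have h2 : ContMDiff (I.prod 𝓘(ℝ, ℝ)) 𝓘(ℝ, ℝ).tangent ∞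
      (fun p : M × ℝ => (⟨p.2, c p⟩ : TangentBundle 𝓘(ℝ, ℝ) ℝ)) := by
    intro p
    refine contMDiffAt_totalSpace.2 ⟨contMDiffAt_snd, (c.contMDiff p).congr_of_eventuallyEq
      (Filter.Eventually.of_forall fun q => ?_)⟩
    simp
  exact contMDiff_equivTangentBundleProd_symm.comp (hv.prodMk h2)

lemma dir_prod (f : Fn (I.prod 𝓘(ℝ, ℝ)) (M × ℝ)) (p : M × ℝ) (v : TangentSpace I p.1) (c : ℝ) :
    dir (I := I.prod 𝓘(ℝ, ℝ)) f p (v, c) =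
      dir (sliceFn f p.2) p.1 v + c * deriv (fun s => f (p.1, s)) p.2 := by
  have h := mfderiv_prod_eq_add_apply (v := ((v, c) : TangentSpace (I.prod 𝓘(ℝ, ℝ)) p))
    (f.mdifferentiableAt (x := p))
  refine h.trans (congrArg (dir (sliceFn f p.2) p.1 v + ·) ?_)
  show (mfderiv 𝓘(ℝ, ℝ) 𝓘(ℝ, ℝ) (fun s => f (p.1, s)) p.2 c : ℝ) = _
  rw [mfderiv_eq_fderiv]
  have h1 : c = c • (1 : ℝ) := by simp
  rw [h1]
  exact (map_smul (fderiv ℝ (fun s => f (p.1, s)) p.2) c (1 : ℝ)).trans (by simp)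

/-- The function `∂f/∂t`. -/
def dtFn (f : Fn (I.prod 𝓘(ℝ, ℝ)) (M × ℝ)) : Fn (I.prod 𝓘(ℝ, ℝ)) (M × ℝ) :=
  ⟨fun p => deriv (fun s => f (p.1, s)) p.2, by
    have h0 : ContMDiff (I.prod 𝓘(ℝ, ℝ)) I.tangent ∞
        (fun p : M × ℝ => (⟨p.1, 0⟩ : TangentBundle I M)) :=
      (contMDiff_zeroSection ℝ (TangentSpace I)).comp contMDiff_fst
    have h := contMDiff_dir f (contMDiff_vectorField h0 1)
    refine h.congr fun p => ?_
    have := dir_prod f p 0 1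
    rw [one_mul] at this
    refine Eq.trans ?_ this.symm
    simp only [dir, map_zero]
    exact (zero_add _).symm⟩

variable [FiniteDimensional ℝ E] [T2Space M]

lemma exists_sec (s : ∀ x, V x) {U : Set M} (hU : IsOpen U) {x₀ : M} (hx : x₀ ∈ U)
    (hs : ContMDiffOn I (I.prod 𝓘(ℝ, F)) ∞ (fun x => TotalSpace.mk' F x (s x)) U) :
    ∃ S : Sec I F V, ∀ᶠ x in 𝓝 x₀, S x = s x := by
  obtain ⟨ρ, -, hρ⟩ :=
    (SmoothBumpFunction.nhds_basis_tsupport (I := I) x₀).mem_iff.1 (hU.mem_nhds hx)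
  refine ⟨⟨fun x => ρ x • s x, ContMDiffOn.smul_section_of_tsupport
    ρ.contMDiff.contMDiffOn hU hρ hs⟩, ?_⟩
  filter_upwards [ρ.eventuallyEq_one] with x hx
  show ρ x • s x = s x
  rw [hx]
  simp

variable [FiniteDimensional ℝ F] [ContMDiffVectorBundle ∞ F V I]

/-- Sections that form, near `x₀`, the local frame given by the trivialization at `x₀`. -/
lemma exists_frame (x₀ : M) : ∃ e : Fin (Module.finrank ℝ F) → Sec I F V,
    ∀ᶠ x in 𝓝 x₀, ∀ v : V x, v =
      ∑ i, (Module.finBasis ℝ F).repr (trivializationAt F V x₀ ⟨x, v⟩).2 i • e i x := by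
  let t := trivializationAt F V x₀
  let b := Module.finBasis ℝ F
  have hx : x₀ ∈ t.baseSet := FiberBundle.mem_baseSet_trivializationAt F V x₀
  choose e he using fun i => exists_sec (t.localFrame b i) t.open_baseSet hx
    (t.contMDiffOn_localFrame_baseSet (I := I) ∞ b i)
  refine ⟨e, ?_⟩
  filter_upwards [Filter.eventually_all.2 he, t.open_baseSet.mem_nhds hx] with x h1 h2 v
  have h3 := (t.basisAt b h2).sum_repr v
  rw [← h3]
  simp only [h1, t.localFrame_apply_of_mem_baseSet b h2]
  rw [h3]
  exact h3.symm

/-- The dual bundle of `V`. -/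
abbrev DualBundle (V : M → Type*) [∀ x, AddCommGroup (V x)] [∀ x, Module ℝ (V x)]
    [∀ x, TopologicalSpace (V x)] : M → Type _ := fun x => V x →L[ℝ] Bundle.Trivial M ℝ x

variable (I F V) in
/-- The pairing of `V` with its dual bundle. -/
def canon : DualPair I F V (F →L[ℝ] ℝ) (DualBundle V) where
  pair x :=
    { toFun := fun v =>
        { toFun := fun α => α v, map_add' := fun _ _ => rfl, map_smul' := fun _ _ => rfl }
      map_add' := fun v w => LinearMap.ext fun α => map_add α v w
      map_smul' := fun c v => LinearMap.ext fun α => map_smul α c v }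
  smooth X β := by
    have h := ContMDiff.clm_bundle_apply (b := id) β.contMDiff X.contMDiff
    intro x
    exact (contMDiffAt_totalSpace.1 (h x)).2
  frame x₀ := by
    obtain ⟨e, he⟩ := exists_frame (I := I) (F := F) (V := V) x₀
    let t := trivializationAt F V x₀
    let b := Module.finBasis ℝ F
    have hx : x₀ ∈ t.baseSet := FiberBundle.mem_baseSet_trivializationAt F V x₀
    let ε₀ : Fin (Module.finrank ℝ F) → ∀ x, V x →L[ℝ] Bundle.Trivial M ℝ x := fun i x =>
      (LinearMap.toContinuousLinearMap (b.coord i)).comp (t.continuousLinearMapAt ℝ x)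
    have hε₀ : ∀ i, ContMDiffOn I (I.prod 𝓘(ℝ, F →L[ℝ] ℝ)) ∞
        (fun x => TotalSpace.mk' (F →L[ℝ] ℝ) x (ε₀ i x)) t.baseSet := by
      intro i
      have hb : (trivializationAt (F →L[ℝ] ℝ) (fun x => V x →L[ℝ] Bundle.Trivial M ℝ x) x₀).baseSet =
          t.baseSet := by
        rw [hom_trivializationAt_baseSet]
        exact Set.inter_univ _
      rw [← hb, Bundle.Trivialization.contMDiffOn_section_baseSet_iff]
      refine (contMDiffOn_const (c := LinearMap.toContinuousLinearMap (b.coord i))).congr ?_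
      intro x hx'
      rw [hb] at hx'
      rw [hom_trivializationAt_apply]
      ext u
      have h5 : t.continuousLinearMapAt ℝ x (t.symmL ℝ x u) = u :=
        Trivialization.continuousLinearMapAt_symmL t hx' u
      simp [ContinuousLinearMap.inCoordinates, ε₀]
      exact congrArg (fun z => b.repr z i) h5
    choose ε hε using fun i => exists_sec (ε₀ i) t.open_baseSet hx (hε₀ i)
    refine ⟨_, e, ε, ?_⟩
    filter_upwards [he, Filter.eventually_all.2 hε, t.open_baseSet.mem_nhds hx] with x h1 h2 h3
    have h4 : ∀ v : V x, v = ∑ i, (ε i x v : ℝ) • e i x := by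
      intro v
      refine (h1 v).trans (Finset.sum_congr rfl fun i _ => ?_)
      rw [h2 i]
      congr 1
      show _ = b.repr (t.continuousLinearMapAt ℝ x v) i
      rw [Trivialization.continuousLinearMapAt_apply, t.linearMapAt_apply, if_pos h3]
    refine ⟨h4, fun w => ContinuousLinearMap.ext fun v => ?_⟩
    conv_lhs => rw [h4 v]
    rw [map_sum, sum_apply]
    refine Finset.sum_congr rfl fun i _ => ?_
    rw [map_smul]
    exact mul_comm _ _

namespace DualPair

variable [FiniteDimensional ℝ F'] [ContMDiffVectorBundle ∞ F' V' I]
  (P : DualPair I F V F' V')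

lemma pair_sum {x : M} {n : ℕ} (c : Fin n → ℝ) (v : Fin n → V x) (w : V' x) :
    P.pair x (∑ i, c i • v i) w = ∑ i, c i * P.pair x (v i) w := by
  simp

lemma contMDiff_coef (X : Sec (I.prod 𝓘(ℝ, ℝ)) F (Tilde V)) (β : Sec I F' V') :
    ContMDiff (I.prod 𝓘(ℝ, ℝ)) 𝓘(ℝ, ℝ) ∞ fun p : M × ℝ => P.pair p.1 (X p) (β p.1) := by
  intro p₀
  obtain ⟨e, he⟩ := exists_frame (I := I) (F := F) (V := V) p₀.1
  have hX := (contMDiffAt_totalSpace.1 ((contMDiff_tilde_iff fun p => X p).1 X.contMDiff p₀)).2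
  have h : ContMDiffAt (I.prod 𝓘(ℝ, ℝ)) 𝓘(ℝ, ℝ) ∞ (fun p : M × ℝ => ∑ i,
      (Module.finBasis ℝ F).repr (trivializationAt F V p₀.1 ⟨p.1, X p⟩).2 i *
        P.fn (e i) β p.1) p₀ := by
    refine ContMDiffAt.sum fun i _ => ContMDiffAt.mul ?_
      ((P.fn (e i) β).contMDiff.comp contMDiff_fst p₀)
    exact (LinearMap.toContinuousLinearMap
      ((Module.finBasis ℝ F).coord i)).contMDiff.contMDiffAt.comp p₀ hX
  refine h.congr_of_eventuallyEq ((continuous_fst.continuousAt (x := p₀)).eventually he |>.mono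
    fun p hp => ?_)
  have h1 := congrArg (fun v : V p.1 => P.pair p.1 v (β p.1)) (hp (X p))
  exact h1.trans (P.pair_sum _ _ _)

/-- The pairing of `V × ℝ` and `V' × ℝ` over `M × ℝ` induced by a pairing of `V` and `V'`. -/
def tilde : DualPair (I.prod 𝓘(ℝ, ℝ)) F (Tilde V) F' (Tilde V') where
  pair p := P.pair p.1
  smooth X β := by
    intro p₀
    obtain ⟨n, e, ε, hf⟩ := P.frame p₀.1
    have h : ContMDiffAt (I.prod 𝓘(ℝ, ℝ)) 𝓘(ℝ, ℝ) ∞ (fun p : M × ℝ => ∑ i,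
        P.pair p.1 (X p) (ε i p.1) * P.swap.pair p.1 (β p) (e i p.1)) p₀ :=
      ContMDiffAt.sum fun i _ =>
        ContMDiffAt.mul (P.contMDiff_coef X (ε i) p₀) (P.swap.contMDiff_coef β (e i) p₀)
    refine h.congr_of_eventuallyEq ((continuous_fst.continuousAt (x := p₀)).eventually hf |>.mono
      fun p hp => ?_)
    have h1 := congrArg (fun v : V p.1 => P.pair p.1 v (β p)) (hp.1 (X p))
    exact h1.trans (P.pair_sum _ _ _)
  frame p₀ := by
    obtain ⟨n, e, ε, hf⟩ := P.frame p₀.1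
    exact ⟨n, fun i => pull (e i), fun i => pull (ε i),
      (continuous_fst.continuousAt (x := p₀)).eventually hf⟩

end DualPair

/-- The derivative in `t` of a time-dependent section, computed in the fibres of `V` (which are
identified with `F` by a linear isomorphism). -/
def dtRaw (X : Sec (I.prod 𝓘(ℝ, ℝ)) F (Tilde V)) (p : M × ℝ) : V p.1 :=
  (VectorBundle.continuousLinearEquivAt ℝ F V p.1).symm
    (deriv (fun s => VectorBundle.continuousLinearEquivAt ℝ F V p.1 (X (p.1, s))) p.2)

namespace DualPair

variable [FiniteDimensional ℝ F'] [ContMDiffVectorBundle ∞ F' V' I]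
  (P : DualPair I F V F' V')

/-- The coefficient functions of a time-dependent section. -/
def coef (X : Sec (I.prod 𝓘(ℝ, ℝ)) F (Tilde V)) (β : Sec I F' V') :
    Fn (I.prod 𝓘(ℝ, ℝ)) (M × ℝ) := ⟨_, P.contMDiff_coef X β⟩

lemma differentiable_fn (f : Fn (I.prod 𝓘(ℝ, ℝ)) (M × ℝ)) (x : M) :
    Differentiable ℝ fun s => f (x, s) := by
  have h : ContMDiff 𝓘(ℝ, ℝ) 𝓘(ℝ, ℝ) ∞ fun s : ℝ => f (x, s) :=
    f.contMDiff.comp (contMDiff_const.prodMk contMDiff_id)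
  exact h.contDiff.differentiable (by simp)

/-- Time-dependent sections are differentiable in time. -/
lemma hasDerivAt (X : Sec (I.prod 𝓘(ℝ, ℝ)) F (Tilde V)) (p : M × ℝ) {n : ℕ}
    {e : Fin n → Sec I F V} {ε : Fin n → Sec I F' V'}
    (h : ∀ v, v = ∑ i, P.pair p.1 v (ε i p.1) • e i p.1) :
    HasDerivAt (fun s => VectorBundle.continuousLinearEquivAt ℝ F V p.1 (X (p.1, s)))
      (∑ i, dtFn (P.coef X (ε i)) p • VectorBundle.continuousLinearEquivAt ℝ F V p.1 (e i p.1))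
      p.2 := by
  have h1 : (fun s => VectorBundle.continuousLinearEquivAt ℝ F V p.1 (X (p.1, s))) =
      fun s => ∑ i, P.coef X (ε i) (p.1, s) •
        VectorBundle.continuousLinearEquivAt ℝ F V p.1 (e i p.1) := by
    funext s
    refine (congrArg (VectorBundle.continuousLinearEquivAt ℝ F V p.1) (h (X (p.1, s)))).trans ?_
    simp only [map_sum, map_smul]
    rfl
  rw [h1]
  exact HasDerivAt.fun_sum fun i _ =>
    ((differentiable_fn (P.coef X (ε i)) p.1).differentiableAt.hasDerivAt).smul_const _

lemma dtRaw_eq (X : Sec (I.prod 𝓘(ℝ, ℝ)) F (Tilde V)) (p : M × ℝ) {n : ℕ}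
    {e : Fin n → Sec I F V} {ε : Fin n → Sec I F' V'}
    (h : ∀ v, v = ∑ i, P.pair p.1 v (ε i p.1) • e i p.1) :
    dtRaw X p = ∑ i, dtFn (P.coef X (ε i)) p • e i p.1 := by
  rw [dtRaw, (P.hasDerivAt X p h).deriv]
  simp only [map_sum, map_smul, ContinuousLinearEquiv.symm_apply_apply]

/-- The section `∂X/∂t`. -/
def dt (X : Sec (I.prod 𝓘(ℝ, ℝ)) F (Tilde V)) : Sec (I.prod 𝓘(ℝ, ℝ)) F (Tilde V) :=
  ⟨dtRaw X, by
    intro p₀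
    obtain ⟨n, e, ε, hf⟩ := P.frame p₀.1
    have h : ContMDiffAt (I.prod 𝓘(ℝ, ℝ)) ((I.prod 𝓘(ℝ, ℝ)).prod 𝓘(ℝ, F)) ∞
        (fun p => TotalSpace.mk' F (E := Tilde V) p
          (∑ i, dtFn (P.coef X (ε i)) p • pull (e i) p)) p₀ :=
      ContMDiffAt.sum_section fun i _ =>
        ((dtFn (P.coef X (ε i))).contMDiff.smul_section (pull (e i)).contMDiff) p₀
    refine h.congr_of_eventuallyEq ((continuous_fst.continuousAt (x := p₀)).eventually hf |>.mono
      fun p hp => ?_)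
    exact congrArg (TotalSpace.mk' F (E := Tilde V) p) (P.dtRaw_eq X p hp.1)⟩

lemma differentiableAt (P : DualPair I F V F' V')
    (X : Sec (I.prod 𝓘(ℝ, ℝ)) F (Tilde V)) (p : M × ℝ) :
    DifferentiableAt ℝ (fun s => VectorBundle.continuousLinearEquivAt ℝ F V p.1 (X (p.1, s)))
      p.2 := by
  obtain ⟨n, e, ε, hf⟩ := P.frame p.1
  exact (P.hasDerivAt X p hf.self_of_nhds.1).differentiableAt

lemma dt_add (X Y : Sec (I.prod 𝓘(ℝ, ℝ)) F (Tilde V)) : P.dt (X + Y) = P.dt X + P.dt Y := by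
  ext p
  have h : deriv (fun s => VectorBundle.continuousLinearEquivAt ℝ F V p.1 ((X + Y) (p.1, s))) p.2 =
      deriv (fun s => VectorBundle.continuousLinearEquivAt ℝ F V p.1 (X (p.1, s))) p.2 +
      deriv (fun s => VectorBundle.continuousLinearEquivAt ℝ F V p.1 (Y (p.1, s))) p.2 := by
    rw [← deriv_fun_add (P.differentiableAt X p) (P.differentiableAt Y p)]
    congr 1
    funext s
    exact map_add _ _ _
  exact (congrArg (VectorBundle.continuousLinearEquivAt ℝ F V p.1).symm h).trans (map_add _ _ _)

lemma symm_apply_of_eq {x : M} (Λ : V x ≃L[ℝ] F) {a b : F} {v : V x} {c d : ℝ}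
    (h : b = c • a + d • Λ v) : Λ.symm b = c • Λ.symm a + d • v := by
  rw [h, map_add, map_smul, map_smul, ContinuousLinearEquiv.symm_apply_apply]

lemma dt_fsmul (f : Fn (I.prod 𝓘(ℝ, ℝ)) (M × ℝ)) (X : Sec (I.prod 𝓘(ℝ, ℝ)) F (Tilde V)) :
    P.dt (f • X) = f • P.dt X + dtFn f • X := by
  ext p
  have h : deriv (fun s => VectorBundle.continuousLinearEquivAt ℝ F V p.1 ((f • X) (p.1, s))) p.2 =
      f p • deriv (fun s => VectorBundle.continuousLinearEquivAt ℝ F V p.1 (X (p.1, s))) p.2 +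
      dtFn f p • VectorBundle.continuousLinearEquivAt ℝ F V p.1 (X p) := by
    refine Eq.trans ?_
      (deriv_fun_smul ((differentiable_fn f p.1) p.2) (P.differentiableAt X p))
    congr 1
    funext s
    exact map_smul (VectorBundle.continuousLinearEquivAt ℝ F V p.1) (f (p.1, s)) (X (p.1, s))
  exact symm_apply_of_eq (VectorBundle.continuousLinearEquivAt ℝ F V p.1) h

lemma dt_smul (c : ℝ) (X : Sec (I.prod 𝓘(ℝ, ℝ)) F (Tilde V)) : P.dt (c • X) = c • P.dt X := by
  ext p
  have h : deriv (fun s => VectorBundle.continuousLinearEquivAt ℝ F V p.1 ((c • X) (p.1, s))) p.2 =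
      c • deriv (fun s => VectorBundle.continuousLinearEquivAt ℝ F V p.1 (X (p.1, s))) p.2 := by
    rw [← deriv_fun_const_smul c (P.differentiableAt X p)]
    congr 1
    funext s
    exact map_smul (VectorBundle.continuousLinearEquivAt ℝ F V p.1) c (X (p.1, s))
  exact (congrArg (VectorBundle.continuousLinearEquivAt ℝ F V p.1).symm h).trans (map_smul _ _ _)

end DualPair

namespace SkewAlgebroid

variable (𝒜 : SkewAlgebroid I F V)

lemma bracket_local (X : Sec I F V) {Y : Sec I F V} {x : M} (h : ∀ᶠ y in 𝓝 x, Y y = 0) :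
    𝒜.bracket X Y x = 0 := by
  obtain ⟨g, hg, hp⟩ := exists_cutoff (I := I) h
  have h1 : Y = g • Y := by
    ext y
    rw [fsmul_apply]
    rcases hp y with h | h <;> simp [h]
  rw [h1, 𝒜.leibniz, hg, h.self_of_nhds]
  simp

lemma bracket_sum (X : Sec I F V) {n : ℕ} (Y : Fin n → Sec I F V) :
    𝒜.bracket X (∑ i, Y i) = ∑ i, 𝒜.bracket X (Y i) :=
  map_sum (AddMonoidHom.mk' (𝒜.bracket X) (𝒜.bracket_add X)) Y Finset.univ

lemma sec_sum_apply {n : ℕ} (Y : Fin n → Sec I F V) (x : M) : (∑ i, Y i) x = ∑ i, Y i x := by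
  rw [← ContMDiffSection.coeAddHom_apply, map_sum, Finset.sum_apply]
  rfl

variable (P : DualPair I F V F' V')

lemma bracket_expand (X Y : Sec I F V) {x : M} {n : ℕ} {e : Fin n → Sec I F V}
    {ε : Fin n → Sec I F' V'} (h : ∀ᶠ y in 𝓝 x, ∀ v, v = ∑ i, P.pair y v (ε i y) • e i y) :
    𝒜.bracket X Y x = ∑ i, (P.pair x (Y x) (ε i x) • 𝒜.bracket X (e i) x +
      dir (P.fn Y (ε i)) x (𝒜.anchor x (X x)) • e i x) := by
  have h0 : 𝒜.bracket X (Y - ∑ i, P.fn Y (ε i) • e i) x = 0 := by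
    apply bracket_local
    filter_upwards [h] with y hy
    rw [ContMDiffSection.coe_sub, Pi.sub_apply, sec_sum_apply, sub_eq_zero]
    exact hy (Y y)
  have h1 : Y = (Y - ∑ i, P.fn Y (ε i) • e i) + ∑ i, P.fn Y (ε i) • e i := by abel
  conv_lhs => rw [h1]
  rw [bracket_add, ContMDiffSection.coe_add, Pi.add_apply, h0, zero_add, bracket_sum,
    sec_sum_apply]
  exact Finset.sum_congr rfl fun i _ => 𝒜.leibniz X (e i) (P.fn Y (ε i)) x

variable [FiniteDimensional ℝ F'] [ContMDiffVectorBundle ∞ F' V' I]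

lemma contMDiff_anchor (P : DualPair I F V F' V')
    (X : Sec (I.prod 𝓘(ℝ, ℝ)) F (Tilde V)) :
    ContMDiff (I.prod 𝓘(ℝ, ℝ)) I.tangent ∞
      (fun p : M × ℝ => (⟨p.1, 𝒜.anchor p.1 (X p)⟩ : TangentBundle I M)) := by
  refine (contMDiff_tilde_iff (F := E) (V := TangentSpace I) fun p => 𝒜.anchor p.1 (X p)).1 ?_
  intro p₀
  obtain ⟨n, e, ε, hf⟩ := P.frame p₀.1
  let a : Fin n → Sec I E (TangentSpace I) := fun i =>
    ⟨fun x => 𝒜.anchor x (e i x), 𝒜.smooth_anchor (e i)⟩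
  have h : ContMDiffAt (I.prod 𝓘(ℝ, ℝ)) ((I.prod 𝓘(ℝ, ℝ)).prod 𝓘(ℝ, E)) ∞
      (fun p => TotalSpace.mk' E (E := Tilde (TangentSpace I)) p
        (∑ i, P.coef X (ε i) p • pull (a i) p)) p₀ :=
    ContMDiffAt.sum_section fun i _ =>
      ((P.coef X (ε i)).contMDiff.smul_section (pull (a i)).contMDiff) p₀
  refine h.congr_of_eventuallyEq ((continuous_fst.continuousAt (x := p₀)).eventually hf |>.mono
    fun p hp => ?_)
  refine congrArg (TotalSpace.mk' E (E := Tilde (TangentSpace I)) p) ?_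
  refine (congrArg (𝒜.anchor p.1) (hp.1 (X p))).trans ?_
  simp only [map_sum, map_smul]
  rfl

lemma contMDiff_act (P : DualPair I F V F' V')
    (X : Sec (I.prod 𝓘(ℝ, ℝ)) F (Tilde V)) (f : Fn (I.prod 𝓘(ℝ, ℝ)) (M × ℝ)) :
    ContMDiff (I.prod 𝓘(ℝ, ℝ)) 𝓘(ℝ, ℝ) ∞
      fun p : M × ℝ => dir (sliceFn f p.2) p.1 (𝒜.anchor p.1 (X p)) := by
  refine (contMDiff_dir f (contMDiff_vectorField (𝒜.contMDiff_anchor P X) 0)).congr fun p => ?_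
  refine Eq.trans ?_ (dir_prod f p (𝒜.anchor p.1 (X p)) 0).symm
  rw [zero_mul, add_zero]

/-- The bracket `[X_t, Y_t](x)`. -/
def timeRaw (X Y : Sec (I.prod 𝓘(ℝ, ℝ)) F (Tilde V)) (p : M × ℝ) : Tilde V p :=
  𝒜.bracket (slice X p.2) (slice Y p.2) p.1

lemma contMDiff_timeRaw_aux (P : DualPair I F V F' V')
    (X Y : Sec (I.prod 𝓘(ℝ, ℝ)) F (Tilde V))
    (hX : ∀ Z : Sec I F V, ContMDiff (I.prod 𝓘(ℝ, ℝ)) ((I.prod 𝓘(ℝ, ℝ)).prod 𝓘(ℝ, F)) ∞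
      (fun p => TotalSpace.mk' F (E := Tilde V) p (𝒜.bracket (slice X p.2) Z p.1))) :
    ContMDiff (I.prod 𝓘(ℝ, ℝ)) ((I.prod 𝓘(ℝ, ℝ)).prod 𝓘(ℝ, F)) ∞
      (fun p => TotalSpace.mk' F (E := Tilde V) p (𝒜.timeRaw X Y p)) := by
  intro p₀
  obtain ⟨n, e, ε, hf⟩ := P.frame p₀.1
  have h : ContMDiffAt (I.prod 𝓘(ℝ, ℝ)) ((I.prod 𝓘(ℝ, ℝ)).prod 𝓘(ℝ, F)) ∞
      (fun p => TotalSpace.mk' F (E := Tilde V) p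
        (∑ i, ((P.coef Y (ε i) p • @id (Tilde V p) (𝒜.bracket (slice X p.2) (e i) p.1) +
          dir (sliceFn (P.coef Y (ε i)) p.2) p.1 (𝒜.anchor p.1 (X p)) • pull (e i) p)))) p₀ :=
    ContMDiffAt.sum_section fun i _ =>
      (((P.coef Y (ε i)).contMDiff.smul_section (hX (e i))).add_section
        ((𝒜.contMDiff_act P X (P.coef Y (ε i))).smul_section (pull (e i)).contMDiff)) p₀
  refine h.congr_of_eventuallyEq
    ((continuous_fst.continuousAt (x := p₀)).eventually hf.eventually_nhds |>.mono fun p hp => ?_)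
  exact congrArg (TotalSpace.mk' F (E := Tilde V) p)
    (𝒜.bracket_expand P (slice X p.2) (slice Y p.2) (hp.mono fun _ h => h.1))

lemma contMDiff_timeRaw (P : DualPair I F V F' V')
    (X Y : Sec (I.prod 𝓘(ℝ, ℝ)) F (Tilde V)) :
    ContMDiff (I.prod 𝓘(ℝ, ℝ)) ((I.prod 𝓘(ℝ, ℝ)).prod 𝓘(ℝ, F)) ∞
      (fun p => TotalSpace.mk' F (E := Tilde V) p (𝒜.timeRaw X Y p)) := by
  refine 𝒜.contMDiff_timeRaw_aux P X Y fun Z => ?_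
  have h := (𝒜.contMDiff_timeRaw_aux P (pull Z) X fun Z' =>
    (pull (𝒜.bracket Z Z')).contMDiff).neg_section
  refine h.congr fun p => ?_
  refine congrArg (TotalSpace.mk' F (E := Tilde V) p) ?_
  exact congrArg (fun S : Sec I F V => S p.1) (𝒜.bracket_skew (slice X p.2) Z)

/-- The bracket `[X, Y]~(x, t) = [X_t, Y_t](x)` of time-dependent sections. -/
def time (X Y : Sec (I.prod 𝓘(ℝ, ℝ)) F (Tilde V)) : Sec (I.prod 𝓘(ℝ, ℝ)) F (Tilde V) :=
  ⟨𝒜.timeRaw X Y, 𝒜.contMDiff_timeRaw P X Y⟩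

lemma time_add (X Y Z : Sec (I.prod 𝓘(ℝ, ℝ)) F (Tilde V)) :
    𝒜.time P X (Y + Z) = 𝒜.time P X Y + 𝒜.time P X Z :=
  ContMDiffSection.ext fun p => congrArg (fun S : Sec I F V => S p.1)
    (𝒜.bracket_add (slice X p.2) (slice Y p.2) (slice Z p.2))

lemma time_smul (c : ℝ) (X Y : Sec (I.prod 𝓘(ℝ, ℝ)) F (Tilde V)) :
    𝒜.time P X (c • Y) = c • 𝒜.time P X Y :=
  ContMDiffSection.ext fun p => congrArg (fun S : Sec I F V => S p.1)
    (𝒜.bracket_smul c (slice X p.2) (slice Y p.2))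

lemma time_skew (X Y : Sec (I.prod 𝓘(ℝ, ℝ)) F (Tilde V)) : 𝒜.time P X Y = -𝒜.time P Y X :=
  ContMDiffSection.ext fun p => congrArg (fun S : Sec I F V => S p.1)
    (𝒜.bracket_skew (slice X p.2) (slice Y p.2))

lemma time_leibniz (X Y : Sec (I.prod 𝓘(ℝ, ℝ)) F (Tilde V))
    (f : Fn (I.prod 𝓘(ℝ, ℝ)) (M × ℝ)) (p : M × ℝ) :
    𝒜.time P X (f • Y) p = f p • 𝒜.time P X Y p +
      dir (sliceFn f p.2) p.1 (𝒜.anchor p.1 (X p)) • Y p :=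
  𝒜.leibniz (slice X p.2) (slice Y p.2) (sliceFn f p.2) p.1

/-- The function `e^{-t}` on `M × ℝ`. -/
def expNeg : Fn (I.prod 𝓘(ℝ, ℝ)) (M × ℝ) :=
  ⟨fun p => Real.exp (-p.2), (Real.contDiff_exp.comp contDiff_neg).contMDiff.comp contMDiff_snd⟩

/-- The structure on `V × ℝ` with the bracket
`[X, Y]~φ = [X, Y]~ + ⟨φ, X⟩ ∂Y/∂t - ⟨φ, Y⟩ ∂X/∂t` and the anchor `X ↦ a(X) + ⟨φ, X⟩ ∂/∂t`. -/
def tilde (φ : Sec I F' V') : SkewAlgebroid (I.prod 𝓘(ℝ, ℝ)) F (Tilde V) where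
  anchor p :=
    { toFun := fun v => (𝒜.anchor p.1 v, P.pair p.1 v (φ p.1))
      map_add' := fun v w =>
        Prod.ext (map_add (𝒜.anchor p.1) v w) (congrArg (· (φ p.1)) (map_add (P.pair p.1) v w))
      map_smul' := fun c v => Prod.ext (map_smul (𝒜.anchor p.1) c v)
        (congrArg (· (φ p.1)) (map_smul (P.pair p.1) c v)) }
  smooth_anchor X := contMDiff_vectorField (𝒜.contMDiff_anchor P X) (P.coef X φ)
  bracket X Y := 𝒜.time P X Y + P.coef X φ • P.dt Y - P.coef Y φ • P.dt X
  bracket_add X Y Z := by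
    have h : P.coef (Y + Z) φ = P.coef Y φ + P.coef Z φ := P.tilde.fn_add_left Y Z (pull φ)
    rw [time_add, DualPair.dt_add, h]
    module
  bracket_smul c X Y := by
    have h : P.coef (c • Y) φ • P.dt X = c • P.coef Y φ • P.dt X := by
      ext p
      have h1 : P.coef (c • Y) φ p = c * P.coef Y φ p :=
        congrArg (· (φ p.1)) (map_smul (P.pair p.1) c (Y p))
      show P.coef (c • Y) φ p • P.dt X p = c • P.coef Y φ p • P.dt X p
      rw [h1, mul_smul]
    have h' : P.coef X φ • (c • P.dt Y) = c • (P.coef X φ • P.dt Y) :=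
      ContMDiffSection.ext fun p => smul_comm (P.coef X φ p) c (P.dt Y p)
    rw [time_smul, DualPair.dt_smul, h, h', smul_sub, smul_add]
  bracket_skew X Y := by
    rw [time_skew]
    abel
  leibniz X Y f p := by
    have h : P.coef (f • Y) φ = f * P.coef Y φ := P.tilde.fn_smul_left f Y (pull φ)
    have h1 : dir (I := I.prod 𝓘(ℝ, ℝ)) f p (𝒜.anchor p.1 (X p), P.coef X φ p) =
        dir (sliceFn f p.2) p.1 (𝒜.anchor p.1 (X p)) + P.coef X φ p * dtFn f p := dir_prod f p _ _
    refine Eq.trans ?_ (congrArg (fun c : ℝ => f p • (𝒜.time P X Y + P.coef X φ • P.dt Y -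
      P.coef Y φ • P.dt X) p + c • Y p) h1.symm)
    rw [DualPair.dt_fsmul, h]
    show 𝒜.time P X (f • Y) p + P.coef X φ p • (f p • P.dt Y p + dtFn f p • Y p) -
      (f p * P.coef Y φ p) • P.dt X p =
      f p • (𝒜.time P X Y p + P.coef X φ p • P.dt Y p - P.coef Y φ p • P.dt X p) +
        (dir (sliceFn f p.2) p.1 (𝒜.anchor p.1 (X p)) + P.coef X φ p * dtFn f p) • Y p
    rw [time_leibniz]
    module

/-- The structure on `V × ℝ` with the bracket
`[X, Y]^φ = e^{-t} ([X, Y]~ + ⟨φ, X⟩ (∂Y/∂t - Y) - ⟨φ, Y⟩ (∂X/∂t - X))` and the anchor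
`X ↦ e^{-t} (a(X) + ⟨φ, X⟩ ∂/∂t)`. -/
def hat (φ : Sec I F' V') : SkewAlgebroid (I.prod 𝓘(ℝ, ℝ)) F (Tilde V) where
  anchor p := Real.exp (-p.2) • (𝒜.tilde P φ).anchor p
  smooth_anchor X :=
    (expNeg (I := I) (M := M)).contMDiff.smul_section ((𝒜.tilde P φ).smooth_anchor X)
  bracket X Y := expNeg • (𝒜.time P X Y + P.coef X φ • (P.dt Y - Y) - P.coef Y φ • (P.dt X - X))
  bracket_add X Y Z := by
    have h : P.coef (Y + Z) φ = P.coef Y φ + P.coef Z φ := P.tilde.fn_add_left Y Z (pull φ)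
    rw [time_add, DualPair.dt_add, h]
    refine Eq.trans ?_ (smul_add (expNeg (I := I) (M := M)) _ _)
    congr 1
    module
  bracket_smul c X Y := by
    have h : 𝒜.time P X (c • Y) + P.coef X φ • (P.dt (c • Y) - c • Y) -
        P.coef (c • Y) φ • (P.dt X - X) = c • (𝒜.time P X Y + P.coef X φ • (P.dt Y - Y) -
          P.coef Y φ • (P.dt X - X)) := by
      ext p
      have h1 : P.coef (c • Y) φ p = c * P.coef Y φ p :=
        congrArg (· (φ p.1)) (map_smul (P.pair p.1) c (Y p))
      rw [time_smul, DualPair.dt_smul]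
      show c • 𝒜.time P X Y p + P.coef X φ p • (c • P.dt Y p - c • Y p) -
        P.coef (c • Y) φ p • (P.dt X p - X p) = c • (𝒜.time P X Y p +
          P.coef X φ p • (P.dt Y p - Y p) - P.coef Y φ p • (P.dt X p - X p))
      rw [h1]
      module
    rw [h]
    exact ContMDiffSection.ext fun p => smul_comm (expNeg p) c _
  bracket_skew X Y := by
    rw [time_skew, ← smul_neg]
    congr 1
    abel
  leibniz X Y f p := by
    have h : P.coef (f • Y) φ = f * P.coef Y φ := P.tilde.fn_smul_left f Y (pull φ)
    have h1 : dir (I := I.prod 𝓘(ℝ, ℝ)) f p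
        (Real.exp (-p.2) • ((𝒜.tilde P φ).anchor p (X p))) = Real.exp (-p.2) *
        (dir (sliceFn f p.2) p.1 (𝒜.anchor p.1 (X p)) + P.coef X φ p * dtFn f p) :=
      (dir_smul_right _ _ _ _).trans (congrArg (Real.exp (-p.2) * ·) (dir_prod f p _ _))
    refine Eq.trans ?_ (congrArg (fun c : ℝ => f p • (expNeg • (𝒜.time P X Y +
      P.coef X φ • (P.dt Y - Y) - P.coef Y φ • (P.dt X - X))) p + c • Y p) h1.symm)
    rw [DualPair.dt_fsmul, h]
    show Real.exp (-p.2) • (𝒜.time P X (f • Y) p +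
        P.coef X φ p • (f p • P.dt Y p + dtFn f p • Y p - f p • Y p) -
        (f p * P.coef Y φ p) • (P.dt X p - X p)) =
      f p • (Real.exp (-p.2) • (𝒜.time P X Y p + P.coef X φ p • (P.dt Y p - Y p) -
        P.coef Y φ p • (P.dt X p - X p))) + (Real.exp (-p.2) *
        (dir (sliceFn f p.2) p.1 (𝒜.anchor p.1 (X p)) + P.coef X φ p * dtFn f p)) • Y p
    rw [time_leibniz]
    module

end SkewAlgebroid

/-- The family of subspaces `{X + e^t α : X + α ∈ L_x}` of the fibres at `(x, t)`. -/
def expand (L : ∀ x, Submodule ℝ (V x × V' x)) (p : M × ℝ) :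
    Submodule ℝ (Tilde V p × Tilde V' p) :=
  (L p.1).map (LinearMap.prodMap LinearMap.id (Real.exp p.2 • LinearMap.id) :
    V p.1 × V' p.1 →ₗ[ℝ] V p.1 × V' p.1)

end Time

end DiracCourant

end

/-!
Rescaling the second component by `e^t` turns the structures on `V × ℝ` and `V' × ℝ` with zero
cocycles into the twisted structures over `M`, up to time derivatives. For sections
`e_i = X_i + α_i` over `M × ℝ` and `Φ_t (X + α) = X + e^t α`, expanding the definitions gives

`⟦Φ e₁, Φ e₂⟧~ (x, t) = Φ_t (⟦(e₁)_t, (e₂)_t⟧ (x) + c₁ ∂e₂/∂t - c₂ ∂e₁/∂t + κ₁ W + κ₂ φ)`,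

where `c_i = ⟨φ, X_i⟩ + ⟨α_i, W⟩` and each of `κ₁`, `κ₂` is a combination of pairings between one of
the sections and the time derivative of the other. This is computed separately for the Lie
derivatives (`slice_tilde_lie`, `slice_hat_lie`) and the differentials of functions
(`slice_tilde_dFn`, `slice_hat_dFn`), by pairing with time-independent sections.

The fibres of `L` do not depend on `t`, so a time-dependent section of `L` has its time derivative in
`L` (`dt_mem`). If `L` is isotropic, then `κ₁` and `κ₂` vanish (`slice_courantBracket_fst`,
`slice_courantBracket_snd`), and the two brackets lie in `Φ_t L` and in `L` at the same points
(`isSection_courantBracket_expSec`). Integrability over `M × ℝ` follows by taking slices, and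
integrability over `M` by pulling sections back and setting `t = 0`. Since `Φ_t` multiplies `( , )₊` by
`e^t`, it preserves maximal isotropic subspaces, and it carries local frames of `L` to local frames.
-/

noncomputable section

namespace DiracCourant

section FixedTime

variable {E : Type*} [NormedAddCommGroup E] [NormedSpace ℝ E] {H : Type*} [TopologicalSpace H]
  {I : ModelWithCorners ℝ E H} {M : Type*} [TopologicalSpace M] [ChartedSpace H M]
  {F : Type*} [NormedAddCommGroup F] [NormedSpace ℝ F]
  {V : M → Type*} [TopologicalSpace (TotalSpace F V)] [∀ x, AddCommGroup (V x)]
  [∀ x, Module ℝ (V x)] [∀ x, TopologicalSpace (V x)] [FiberBundle F V] [VectorBundle ℝ F V]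
  {F' : Type*} [NormedAddCommGroup F'] [NormedSpace ℝ F']
  {V' : M → Type*} [TopologicalSpace (TotalSpace F' V')] [∀ x, AddCommGroup (V' x)]
  [∀ x, Module ℝ (V' x)] [∀ x, TopologicalSpace (V' x)] [FiberBundle F' V'] [VectorBundle ℝ F' V']

/-! ### Smooth sections of direct sums and subbundles -/

lemma contMDiffOn_prod_section_iff (s : ∀ x, V x × V' x) (U : Set M) :
    ContMDiffOn I (I.prod 𝓘(ℝ, F × F')) ∞
      (fun x => TotalSpace.mk' (F × F') (E := V ×ᵇ V') x (s x)) U ↔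
    ContMDiffOn I (I.prod 𝓘(ℝ, F)) ∞ (fun x => TotalSpace.mk' F x (s x).1) U ∧
    ContMDiffOn I (I.prod 𝓘(ℝ, F')) ∞ (fun x => TotalSpace.mk' F' x (s x).2) U := by
  simp only [ContMDiffOn, ← forall_and]
  refine forall₂_congr fun x _ => ?_
  rw [contMDiffWithinAt_section, contMDiffWithinAt_section, contMDiffWithinAt_section]
  exact contMDiffWithinAt_prod_module_iff _

lemma contMDiffOn_tilde {s : ∀ x, V x} {U : Set M}
    (h : ContMDiffOn I (I.prod 𝓘(ℝ, F)) ∞ (fun x => TotalSpace.mk' F x (s x)) U) :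
    ContMDiffOn (I.prod 𝓘(ℝ, ℝ)) ((I.prod 𝓘(ℝ, ℝ)).prod 𝓘(ℝ, F)) ∞
      (fun p : M × ℝ => TotalSpace.mk' F (E := Tilde V) p (s p.1)) (U ×ˢ Set.univ) := by
  intro p hp
  refine (contMDiffWithinAt_section (E := Tilde V) (s := fun p : M × ℝ => s p.1) ..).2 ?_
  exact (contMDiffWithinAt_section.1 (h p.1 hp.1)).comp p contMDiffWithinAt_fst
    (fun q hq => hq.1)

/-- The function `e^t` on `M × ℝ`. -/
def expPos : Fn (I.prod 𝓘(ℝ, ℝ)) (M × ℝ) :=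
  ⟨fun p => Real.exp p.2, Real.contDiff_exp.contMDiff.comp contMDiff_snd⟩

/-- The automorphism `X + α ↦ X + e^t α` of a fibre of `V ⊕ V'`. -/
def expMap (V V' : M → Type*) [∀ x, AddCommGroup (V x)] [∀ x, Module ℝ (V x)]
    [∀ x, AddCommGroup (V' x)] [∀ x, Module ℝ (V' x)] (x : M) (t : ℝ) :
    (V x × V' x) ≃ₗ[ℝ] (V x × V' x) :=
  (LinearEquiv.refl ℝ (V x)).prodCongr
    (LinearEquiv.smulOfNeZero ℝ (V' x) (Real.exp t) (Real.exp_ne_zero t))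

lemma expMap_apply (x : M) (t : ℝ) (e : V x × V' x) :
    expMap V V' x t e = (e.1, Real.exp t • e.2) := rfl

lemma expand_eq_map (L : ∀ x, Submodule ℝ (V x × V' x)) (p : M × ℝ) :
    expand L p = (L p.1).map (expMap V V' p.1 p.2 : V p.1 × V' p.1 →ₗ[ℝ] V p.1 × V' p.1) := rfl

lemma expMap_mem_expand (L : ∀ x, Submodule ℝ (V x × V' x)) (p : M × ℝ) (e : V p.1 × V' p.1) :
    expMap V V' p.1 p.2 e ∈ expand L p ↔ e ∈ L p.1 := by
  rw [expand_eq_map]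
  exact (expMap V V' p.1 p.2).injective.mem_set_image

lemma DualPair.IsSubbundle.expand {L : ∀ x, Submodule ℝ (V x × V' x)}
    (hL : IsSubbundle I F V F' V' L) :
    IsSubbundle (I.prod 𝓘(ℝ, ℝ)) F (Tilde V) F' (Tilde V') (expand L) := by
  intro p₀
  obtain ⟨U, hU, k, s, hs, hspan⟩ := hL p₀.1
  refine ⟨U ×ˢ Set.univ, prod_mem_nhds hU Filter.univ_mem, k,
    fun i p => expMap V V' p.1 p.2 (s i p.1), fun i => ?_, fun p hp => ?_⟩
  · have h := (contMDiffOn_prod_section_iff (s i) U).1 (hs i)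
    exact (contMDiffOn_prod_section_iff (V := Tilde V) (V' := Tilde V')
      (fun p => expMap V V' p.1 p.2 (s i p.1)) (U ×ˢ Set.univ)).2 ⟨contMDiffOn_tilde h.1,
        (expPos (I := I) (M := M)).contMDiff.contMDiffOn.smul_section (contMDiffOn_tilde h.2)⟩
  · obtain ⟨h1, h2⟩ := hspan p.1 hp.1
    refine ⟨h1.map' _ (expMap V V' p.1 p.2).ker, ?_⟩
    rw [expand_eq_map, ← h2]
    refine Eq.trans ?_ (Submodule.map_span _ _).symm
    rw [← Set.range_comp]
    rfl

variable [IsManifold I ∞ M] [FiniteDimensional ℝ E] [T2Space M]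

/-! ### Twisted Lie derivatives and differentials as sections -/

namespace DualPair

variable (P : DualPair I F V F' V') (𝒜 : SkewAlgebroid I F V)

lemma fn_add_right (X : Sec I F V) (α β : Sec I F' V') :
    P.fn X (α + β) = P.fn X α + P.fn X β := P.swap.fn_add_left α β X

lemma fn_smul_right (f : Fn I M) (X : Sec I F V) (α : Sec I F' V') :
    P.fn X (f • α) = f * P.fn X α := P.swap.fn_smul_left f α X

lemma fn_zero_right (X : Sec I F V) : P.fn X (0 : Sec I F' V') = 0 :=
  ContMDiffMap.ext fun x => map_zero (P.pair x (X x))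

lemma fn_zero_left (α : Sec I F' V') : P.fn (0 : Sec I F V) α = 0 := P.swap.fn_zero_right α

lemma fn_lie (φ : Sec I F' V') (X Y : Sec I F V) (β : Sec I F' V') :
    P.fn Y (P.lie 𝒜 φ X β) =
      𝒜.act X (P.fn Y β) - P.fn (𝒜.bracket X Y) β + P.fn X φ * P.fn Y β :=
  (P.fn_rep _ Y).trans (P.lieTwist_form 𝒜 φ X β Y)

lemma fn_dFn (φ : Sec I F' V') (f : Fn I M) (Y : Sec I F V) :
    P.fn Y (P.dFn 𝒜 φ f) = 𝒜.act Y f + P.fn Y φ * f :=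
  (P.fn_rep _ Y).trans (P.dTwist_fn 𝒜 φ f Y)

lemma exists_sec_eq (P : DualPair I F V F' V') (x : M) (v : V x) : ∃ X : Sec I F V, X x = v := by
  obtain ⟨n, e, ε, h⟩ := P.frame x
  refine ⟨∑ i, P.pair x v (ε i x) • e i, ?_⟩
  rw [← ContMDiffSection.coeAddHom_apply, map_sum, Finset.sum_apply]
  exact (h.self_of_nhds.1 v).symm

/-- An element of a fibre of `V'` is determined by its pairings with the sections of `V`. -/
lemma ext_fn {x : M} {w w' : V' x} (h : ∀ Y : Sec I F V, P.pair x (Y x) w = P.pair x (Y x) w') :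
    w = w' := by
  refine P.swap.ext_left fun v => ?_
  obtain ⟨Y, rfl⟩ := P.exists_sec_eq x v
  exact h Y

lemma sec_ext {α β : Sec I F' V'} (h : ∀ Y, P.fn Y α = P.fn Y β) : α = β :=
  ContMDiffSection.ext fun x => P.ext_fn fun Y => congrArg (fun f : Fn I M => f x) (h Y)

lemma formPlus_expMap (x : M) (t : ℝ) (e₁ e₂ : V x × V' x) :
    P.formPlus x (expMap V V' x t e₁) (expMap V V' x t e₂) = Real.exp t * P.formPlus x e₁ e₂ := by
  simp only [formPlus, expMap_apply, map_smul, smul_eq_mul]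
  ring

lemma isIsotropic_map_expMap {x : M} (t : ℝ) {N : Submodule ℝ (V x × V' x)} :
    P.IsIsotropic x (N.map (expMap V V' x t : V x × V' x →ₗ[ℝ] V x × V' x)) ↔
      P.IsIsotropic x N := by
  simp only [IsIsotropic, Submodule.mem_map, forall_exists_index, and_imp,
    forall_apply_eq_imp_iff₂]
  refine forall₂_congr fun e₁ _ => forall₂_congr fun e₂ _ => ?_
  refine Eq.congr_left (P.formPlus_expMap x t e₁ e₂) |>.trans ?_
  simp [Real.exp_ne_zero]

/-- `X + α ↦ X + e^t α` multiplies `( , )₊` by `e^t`, so it preserves maximal isotropic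
subspaces. -/
lemma maximal_map_expMap {x : M} (t : ℝ) {L : Submodule ℝ (V x × V' x)} :
    (∀ N, P.IsIsotropic x N →
      L.map (expMap V V' x t : V x × V' x →ₗ[ℝ] V x × V' x) ≤ N →
        N = L.map (expMap V V' x t : V x × V' x →ₗ[ℝ] V x × V' x)) ↔
      ∀ N, P.IsIsotropic x N → L ≤ N → N = L := by
  have hinj := Submodule.map_injective_of_injective
    (f := (expMap V V' x t : V x × V' x →ₗ[ℝ] V x × V' x)) (expMap V V' x t).injective
  constructor
  · intro h N hN hLN
    exact hinj (h _ ((P.isIsotropic_map_expMap t).2 hN) (Submodule.map_mono hLN))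
  · intro h N hN hLN
    have hN' : (N.comap (expMap V V' x t : V x × V' x →ₗ[ℝ] V x × V' x)).map
        (expMap V V' x t : V x × V' x →ₗ[ℝ] V x × V' x) = N :=
      Submodule.map_comap_eq_of_surjective (expMap V V' x t).surjective N
    rw [← hN'] at hN ⊢
    rw [h _ ((P.isIsotropic_map_expMap t).1 hN) (Submodule.map_le_iff_le_comap.1 hLN)]

end DualPair

end FixedTime

section TimeDependent

variable {E : Type*} [NormedAddCommGroup E] [NormedSpace ℝ E] {H : Type*} [TopologicalSpace H]
  {I : ModelWithCorners ℝ E H} {M : Type*} [TopologicalSpace M] [ChartedSpace H M]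
  {F : Type*} [NormedAddCommGroup F] [NormedSpace ℝ F]
  {V : M → Type*} [TopologicalSpace (TotalSpace F V)] [∀ x, AddCommGroup (V x)]
  [∀ x, Module ℝ (V x)] [∀ x, TopologicalSpace (V x)] [FiberBundle F V] [VectorBundle ℝ F V]
  {F' : Type*} [NormedAddCommGroup F'] [NormedSpace ℝ F']
  {V' : M → Type*} [TopologicalSpace (TotalSpace F' V')] [∀ x, AddCommGroup (V' x)]
  [∀ x, Module ℝ (V' x)] [∀ x, TopologicalSpace (V' x)] [FiberBundle F' V'] [VectorBundle ℝ F' V']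
  [IsManifold I ∞ M] [FiniteDimensional ℝ E] [T2Space M]
  [FiniteDimensional ℝ F] [ContMDiffVectorBundle ∞ F V I]
  [FiniteDimensional ℝ F'] [ContMDiffVectorBundle ∞ F' V' I]

/-! ### Time-dependent sections -/

lemma hasDerivAt_fn (f : Fn (I.prod 𝓘(ℝ, ℝ)) (M × ℝ)) (p : M × ℝ) :
    HasDerivAt (fun s => f (p.1, s)) (dtFn f p) p.2 :=
  (DualPair.differentiable_fn f p.1).differentiableAt.hasDerivAt

lemma dtFn_expPos : dtFn (expPos (I := I) (M := M)) = expPos :=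
  ContMDiffMap.ext fun p => (Real.hasDerivAt_exp p.2).deriv

lemma dtFn_mul (f g : Fn (I.prod 𝓘(ℝ, ℝ)) (M × ℝ)) :
    dtFn (f * g) = dtFn f * g + f * dtFn g :=
  ContMDiffMap.ext fun p => ((hasDerivAt_fn f p).mul (hasDerivAt_fn g p)).deriv

lemma expPos_expNeg_smul (X : Sec (I.prod 𝓘(ℝ, ℝ)) F (Tilde V)) :
    expPos (I := I) (M := M) • SkewAlgebroid.expNeg (I := I) (M := M) • X = X := by
  ext p
  show Real.exp p.2 • Real.exp (-p.2) • X p = X p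
  rw [smul_smul, ← Real.exp_add, add_neg_cancel, Real.exp_zero, one_smul]

namespace DualPair

variable (P : DualPair I F V F' V')

/-- Linear functionals on a fibre of `V ⊕ V'` commute with `∂/∂t`. -/
lemma hasDerivAt_linear (X : Sec (I.prod 𝓘(ℝ, ℝ)) F (Tilde V))
    (α : Sec (I.prod 𝓘(ℝ, ℝ)) F' (Tilde V')) (p : M × ℝ)
    (l : V p.1 × V' p.1 →ₗ[ℝ] ℝ) :
    HasDerivAt (fun s => l (X (p.1, s), α (p.1, s))) (l (P.dt X p, P.swap.dt α p)) p.2 := by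
  obtain ⟨n, e, ε, hf⟩ := P.frame p.1
  have h1 := hf.self_of_nhds.1
  have h2 := hf.self_of_nhds.2
  have hl : ∀ (v : V p.1) (w : V' p.1), l (v, w) =
      l.comp (LinearMap.inl ..) v + l.comp (LinearMap.inr ..) w := fun v w => by
    simp [← map_add]
  have e1 : ∀ s, l (X (p.1, s), α (p.1, s)) =
      ∑ i, P.coef X (ε i) (p.1, s) * l (e i p.1, 0) +
      ∑ i, P.swap.coef α (e i) (p.1, s) * l (0, ε i p.1) := fun s => by
    refine (hl _ _).trans (congrArg₂ (· + ·) ?_ ?_)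
    · refine (congrArg (l.comp (LinearMap.inl ..)) (h1 (X (p.1, s)))).trans ?_
      simp only [map_sum, map_smul]
      rfl
    · refine (congrArg (l.comp (LinearMap.inr ..)) (h2 (α (p.1, s)))).trans ?_
      simp only [map_sum, map_smul]
      rfl
  have e2 : l (P.dt X p, P.swap.dt α p) =
      ∑ i, dtFn (P.coef X (ε i)) p * l (e i p.1, 0) +
      ∑ i, dtFn (P.swap.coef α (e i)) p * l (0, ε i p.1) := by
    refine (hl _ _).trans (congrArg₂ (· + ·) ?_ ?_)
    · refine (congrArg (l.comp (LinearMap.inl ..)) (P.dtRaw_eq X p h1)).trans ?_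
      simp only [map_sum, map_smul]
      rfl
    · refine (congrArg (l.comp (LinearMap.inr ..)) (P.swap.dtRaw_eq α p h2)).trans ?_
      simp only [map_sum, map_smul]
      rfl
  rw [e2, funext e1]
  exact (HasDerivAt.fun_sum fun i _ => (hasDerivAt_fn _ p).mul_const _).add
    (HasDerivAt.fun_sum fun i _ => (hasDerivAt_fn _ p).mul_const _)

/-- If a time-dependent section stays in a fixed subspace of the fibre, so does its time
derivative. -/
lemma dt_mem (X : Sec (I.prod 𝓘(ℝ, ℝ)) F (Tilde V)) (α : Sec (I.prod 𝓘(ℝ, ℝ)) F' (Tilde V'))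
    (p : M × ℝ) (N : Submodule ℝ (V p.1 × V' p.1))
    (h : ∀ s, ((X (p.1, s), α (p.1, s)) : V p.1 × V' p.1) ∈ N) :
    ((P.dt X p, P.swap.dt α p) : V p.1 × V' p.1) ∈ N := by
  by_contra hn
  obtain ⟨l, hl, hN⟩ := Submodule.exists_le_ker_of_notMem hn
  refine hl ((P.hasDerivAt_linear X α p l).unique ?_)
  have h0 : (fun s => l (X (p.1, s), α (p.1, s))) = fun _ => 0 := funext fun s => hN (h s)
  rw [h0]
  exact hasDerivAt_const _ _

/-- The product rule for the pairing of time-dependent sections. -/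
lemma dtFn_fn (X : Sec (I.prod 𝓘(ℝ, ℝ)) F (Tilde V)) (α : Sec (I.prod 𝓘(ℝ, ℝ)) F' (Tilde V')) :
    dtFn (P.tilde.fn X α) = P.tilde.fn (P.dt X) α + P.tilde.fn X (P.swap.dt α) := by
  ext p
  obtain ⟨n, e, ε, hf⟩ := P.frame p.1
  have h1 := hf.self_of_nhds.1
  have h2 := hf.self_of_nhds.2
  have e1 : (fun s => P.tilde.fn X α (p.1, s)) =
      fun s => ∑ i, P.coef X (ε i) (p.1, s) * P.swap.coef α (e i) (p.1, s) := funext fun s =>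
    (congrArg (fun v : V p.1 => P.pair p.1 v (α (p.1, s))) (h1 (X (p.1, s)))).trans
      (P.pair_sum _ _ _)
  have e2 : P.pair p.1 (P.dt X p) (α p) =
      ∑ i, dtFn (P.coef X (ε i)) p * P.swap.coef α (e i) p :=
    (congrArg (fun v : V p.1 => P.pair p.1 v (α p)) (P.dtRaw_eq X p h1)).trans (P.pair_sum _ _ _)
  have e3 : P.pair p.1 (X p) (P.swap.dt α p) =
      ∑ i, dtFn (P.swap.coef α (e i)) p * P.coef X (ε i) p :=
    (congrArg (P.pair p.1 (X p)) (P.swap.dtRaw_eq α p h2)).trans (P.swap.pair_sum _ _ (X p))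
  have h : HasDerivAt (fun s => P.tilde.fn X α (p.1, s)) (P.pair p.1 (P.dt X p) (α p) +
      P.pair p.1 (X p) (P.swap.dt α p)) p.2 := by
    rw [e1, e2, e3, ← Finset.sum_add_distrib]
    refine HasDerivAt.fun_sum fun i _ => ?_
    refine ((hasDerivAt_fn (P.coef X (ε i)) p).mul
      (hasDerivAt_fn (P.swap.coef α (e i)) p)).congr_deriv ?_
    exact congrArg (_ + ·) (mul_comm _ _)
  exact h.deriv

lemma dt_pull (X : Sec I F V) : P.dt (pull X) = 0 := by
  ext p
  refine congrArg (VectorBundle.continuousLinearEquivAt ℝ F V p.1).symm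
    (deriv_const (𝕜 := ℝ) p.2 (VectorBundle.continuousLinearEquivAt ℝ F V p.1 (X p.1))) |>.trans ?_
  exact map_zero _

lemma dt_expPos_smul (X : Sec (I.prod 𝓘(ℝ, ℝ)) F (Tilde V)) :
    P.dt (expPos (I := I) (M := M) • X) = expPos (I := I) (M := M) • (P.dt X + X) := by
  rw [dt_fsmul, dtFn_expPos, smul_add]

end DualPair

/-! ### Lie derivatives and differentials of the two structures over `M × ℝ` -/

lemma expNeg_expPos_smul (X : Sec (I.prod 𝓘(ℝ, ℝ)) F (Tilde V)) :
    SkewAlgebroid.expNeg (I := I) (M := M) • expPos (I := I) (M := M) • X = X := by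
  ext p
  show Real.exp (-p.2) • Real.exp p.2 • X p = X p
  rw [smul_smul, ← Real.exp_add, neg_add_cancel, Real.exp_zero, one_smul]

/-- The function `e^t` is constant on the slice at `t`, hence pulls out of derivatives over `M`. -/
lemma SkewAlgebroid.act_sliceFn_expPos_mul (𝒜 : SkewAlgebroid I F V) (X : Sec I F V) (f : Fn I M)
    (t : ℝ) : 𝒜.act X (sliceFn expPos t * f) = sliceFn expPos t * 𝒜.act X f := by
  have h : 𝒜.act X (sliceFn expPos t) = 0 := by
    ext x
    have hc : mfderiv I 𝓘(ℝ, ℝ) (fun _ : M => Real.exp t) x = 0 := mfderiv_const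
    exact congrArg (fun T => (T (𝒜.anchor x (X x)) : ℝ)) hc
  rw [𝒜.act_mul, h, zero_mul, add_zero]

namespace DualPair

variable (P : DualPair I F V F' V') (𝒜 : SkewAlgebroid I F V) (φ : Sec I F' V')

lemma sliceFn_fn (X : Sec (I.prod 𝓘(ℝ, ℝ)) F (Tilde V)) (α : Sec (I.prod 𝓘(ℝ, ℝ)) F' (Tilde V'))
    (t : ℝ) : sliceFn (P.tilde.fn X α) t = P.fn (slice X t) (slice α t) := rfl

lemma sliceFn_tilde_act (X : Sec (I.prod 𝓘(ℝ, ℝ)) F (Tilde V))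
    (f : Fn (I.prod 𝓘(ℝ, ℝ)) (M × ℝ)) (t : ℝ) :
    sliceFn ((𝒜.tilde P φ).act X f) t =
      𝒜.act (slice X t) (sliceFn f t) + P.fn (slice X t) φ * sliceFn (dtFn f) t :=
  ContMDiffMap.ext fun x => dir_prod f (x, t) (𝒜.anchor x (X (x, t))) (P.coef X φ (x, t))

/-- The anchor of `[ , ]^φ` is `e^{-t}` times the anchor of `[ , ]~φ`. -/
lemma hat_act_expPos_smul (X : Sec (I.prod 𝓘(ℝ, ℝ)) F (Tilde V))
    (f : Fn (I.prod 𝓘(ℝ, ℝ)) (M × ℝ)) :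
    (𝒜.hat P φ).act (expPos (I := I) (M := M) • X) f = (𝒜.tilde P φ).act X f := by
  ext p
  have h : (𝒜.hat P φ).anchor p ((expPos (I := I) (M := M) • X) p) =
      (𝒜.tilde P φ).anchor p (X p) := by
    show Real.exp (-p.2) • (𝒜.tilde P φ).anchor p (Real.exp p.2 • X p) = _
    rw [map_smul, smul_smul, ← Real.exp_add, neg_add_cancel, Real.exp_zero, one_smul]
  exact congrArg (dir (I := I.prod 𝓘(ℝ, ℝ)) f p) h

lemma slice_tilde_bracket (X Y : Sec (I.prod 𝓘(ℝ, ℝ)) F (Tilde V)) (t : ℝ) :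
    slice ((𝒜.tilde P φ).bracket X Y) t =
      𝒜.bracket (slice X t) (slice Y t) + P.fn (slice X t) φ • slice (P.dt Y) t -
        P.fn (slice Y t) φ • slice (P.dt X) t := rfl

lemma hat_bracket_expPos_smul (X Y : Sec (I.prod 𝓘(ℝ, ℝ)) F (Tilde V)) :
    (𝒜.hat P φ).bracket (expPos (I := I) (M := M) • X) Y =
      𝒜.time P X Y + P.coef X φ • (P.dt Y - Y) - P.coef Y φ • P.dt X := by
  have hs : 𝒜.time P (expPos (I := I) (M := M) • X) Y =
      expPos (I := I) (M := M) • 𝒜.time P X Y := by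
    ext p
    have h : 𝒜.bracket (Real.exp p.2 • slice X p.2) (slice Y p.2) =
        Real.exp p.2 • 𝒜.bracket (slice X p.2) (slice Y p.2) := by
      rw [𝒜.bracket_skew, 𝒜.bracket_smul, 𝒜.bracket_skew (slice X p.2), smul_neg]
    exact congrArg (fun S : Sec I F V => S p.1) h
  have hc : P.coef (expPos (I := I) (M := M) • X) φ = expPos * P.coef X φ :=
    P.tilde.fn_smul_left expPos X (pull φ)
  show SkewAlgebroid.expNeg (I := I) (M := M) • (𝒜.time P (expPos (I := I) (M := M) • X) Y +
    P.coef (expPos (I := I) (M := M) • X) φ • (P.dt Y - Y) -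
    P.coef Y φ • (P.dt (expPos (I := I) (M := M) • X) - expPos (I := I) (M := M) • X)) = _
  rw [hs, hc, dt_expPos_smul]
  refine Eq.trans ?_ (expNeg_expPos_smul (𝒜.time P X Y + P.coef X φ • (P.dt Y - Y) -
    P.coef Y φ • P.dt X))
  congr 1
  module

/-- In `[e^t X, Y]^φ` the term `-X` of `∂/∂t - 1` cancels against the derivative of `e^t`. -/
lemma slice_hat_bracket_expPos_smul (X Y : Sec (I.prod 𝓘(ℝ, ℝ)) F (Tilde V)) (t : ℝ) :
    slice ((𝒜.hat P φ).bracket (expPos (I := I) (M := M) • X) Y) t =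
      𝒜.bracket (slice X t) (slice Y t) + P.fn (slice X t) φ • (slice (P.dt Y) t - slice Y t) -
        P.fn (slice Y t) φ • slice (P.dt X) t := by
  rw [hat_bracket_expPos_smul]
  rfl

lemma sliceFn_dtFn_fn_pull (Y : Sec I F V) (α : Sec (I.prod 𝓘(ℝ, ℝ)) F' (Tilde V')) (t : ℝ) :
    sliceFn (dtFn (P.tilde.fn (pull Y) α)) t = P.fn Y (slice (P.swap.dt α) t) := by
  rw [dtFn_fn, dt_pull, P.tilde.fn_zero_left, zero_add]
  rfl

lemma dtFn_expPos_mul (f : Fn (I.prod 𝓘(ℝ, ℝ)) (M × ℝ)) :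
    dtFn (expPos * f) = expPos * (f + dtFn f) := by
  rw [dtFn_mul, dtFn_expPos, mul_add]

/-- The untwisted Lie derivative of `e^t α` for the structure `[ , ]~φ`. The twist of the Lie
derivative on the right comes from differentiating the factor `e^t` along `⟨φ, X⟩ ∂/∂t`. -/
lemma slice_tilde_lie (X : Sec (I.prod 𝓘(ℝ, ℝ)) F (Tilde V))
    (α : Sec (I.prod 𝓘(ℝ, ℝ)) F' (Tilde V')) (t : ℝ) :
    slice (P.tilde.lie (𝒜.tilde P φ) 0 X (expPos (I := I) (M := M) • α)) t =
      sliceFn (expPos (I := I) (M := M)) t • (P.lie 𝒜 φ (slice X t) (slice α t) +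
        P.fn (slice X t) φ • slice (P.swap.dt α) t +
          P.fn (slice (P.dt X) t) (slice α t) • φ) := by
  refine P.sec_ext fun Y => ?_
  have h := congrArg (sliceFn · t)
    (P.tilde.fn_lie (𝒜.tilde P φ) 0 X (pull Y) (expPos (I := I) (M := M) • α))
  rw [P.tilde.fn_zero_right, zero_mul, add_zero] at h
  have h1 : P.fn Y (slice (P.tilde.lie (𝒜.tilde P φ) 0 X (expPos (I := I) (M := M) • α)) t) =
      sliceFn ((𝒜.tilde P φ).act X (P.tilde.fn (pull Y) (expPos (I := I) (M := M) • α))) t -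
      P.fn (slice ((𝒜.tilde P φ).bracket X (pull Y)) t)
        (sliceFn (expPos (I := I) (M := M)) t • slice α t) := h
  have h2 : slice (pull Y) t = Y := rfl
  have h3 : slice (P.dt (pull Y)) t = 0 := by rw [dt_pull]; rfl
  have h4 : sliceFn (expPos * P.tilde.fn (pull Y) α) t =
      sliceFn (expPos (I := I) (M := M)) t * P.fn Y (slice α t) := rfl
  have h5 : sliceFn (expPos * (P.tilde.fn (pull Y) α + dtFn (P.tilde.fn (pull Y) α))) t =
      sliceFn (expPos (I := I) (M := M)) t * (P.fn Y (slice α t) +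
        sliceFn (dtFn (P.tilde.fn (pull Y) α)) t) := rfl
  rw [h1, P.tilde.fn_smul_right, sliceFn_tilde_act, slice_tilde_bracket, h2, h3, h4,
    dtFn_expPos_mul, h5, sliceFn_dtFn_fn_pull, 𝒜.act_sliceFn_expPos_mul]
  simp only [fn_smul_right, fn_add_right, fn_lie, fn_sub_left, fn_smul_left, smul_zero, add_zero]
  ring

/-- The untwisted Lie derivative along `e^t X` for the structure `[ , ]^φ`. The twist of the Lie
derivative on the right comes from the term `-⟨φ, X⟩ Y` of the bracket `[e^t X, Y]^φ`. -/
lemma slice_hat_lie (X : Sec (I.prod 𝓘(ℝ, ℝ)) F (Tilde V))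
    (α : Sec (I.prod 𝓘(ℝ, ℝ)) F' (Tilde V')) (t : ℝ) :
    slice (P.tilde.lie (𝒜.hat P φ) 0 (expPos (I := I) (M := M) • X) α) t =
      P.lie 𝒜 φ (slice X t) (slice α t) +
        P.fn (slice X t) φ • slice (P.swap.dt α) t +
          P.fn (slice (P.dt X) t) (slice α t) • φ := by
  refine P.sec_ext fun Y => ?_
  have h := congrArg (sliceFn · t)
    (P.tilde.fn_lie (𝒜.hat P φ) 0 (expPos (I := I) (M := M) • X) (pull Y) α)
  rw [P.tilde.fn_zero_right, zero_mul, add_zero] at h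
  have h1 : P.fn Y (slice (P.tilde.lie (𝒜.hat P φ) 0 (expPos (I := I) (M := M) • X) α) t) =
      sliceFn ((𝒜.hat P φ).act (expPos (I := I) (M := M) • X) (P.tilde.fn (pull Y) α)) t -
      P.fn (slice ((𝒜.hat P φ).bracket (expPos (I := I) (M := M) • X) (pull Y)) t)
        (slice α t) := h
  have h2 : slice (pull Y) t = Y := rfl
  have h3 : slice (P.dt (pull Y)) t = 0 := by rw [dt_pull]; rfl
  rw [h1, hat_act_expPos_smul, sliceFn_tilde_act, slice_hat_bracket_expPos_smul, h2, h3,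
    sliceFn_fn, h2, sliceFn_dtFn_fn_pull]
  simp only [fn_smul_right, fn_add_right, fn_lie, fn_add_left, fn_sub_left, fn_smul_left,
    fn_zero_left]
  ring

/-- The untwisted differential of `e^t f` for the structure `[ , ]~φ`. The twist of the differential
on the right comes from differentiating the factor `e^t` along `∂/∂t`. -/
lemma slice_tilde_dFn (f : Fn (I.prod 𝓘(ℝ, ℝ)) (M × ℝ)) (t : ℝ) :
    slice (P.tilde.dFn (𝒜.tilde P φ) 0 (expPos * f)) t =
      sliceFn (expPos (I := I) (M := M)) t • (P.dFn 𝒜 φ (sliceFn f t) + sliceFn (dtFn f) t • φ) := by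
  refine P.sec_ext fun Y => ?_
  have h := congrArg (sliceFn · t) (P.tilde.fn_dFn (𝒜.tilde P φ) 0 (expPos * f) (pull Y))
  rw [P.tilde.fn_zero_right, zero_mul, add_zero] at h
  refine (show P.fn Y (slice (P.tilde.dFn (𝒜.tilde P φ) 0 (expPos * f)) t) = _ from h).trans ?_
  have h2 : slice (pull Y) t = Y := rfl
  have h4 : sliceFn (expPos * f) t = sliceFn (expPos (I := I) (M := M)) t * sliceFn f t := rfl
  have h5 : sliceFn (expPos * (f + dtFn f)) t =
      sliceFn (expPos (I := I) (M := M)) t * (sliceFn f t + sliceFn (dtFn f) t) := rfl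
  show sliceFn ((𝒜.tilde P φ).act (pull Y) (expPos * f)) t = _
  rw [sliceFn_tilde_act, h2, h4, dtFn_expPos_mul, h5, 𝒜.act_sliceFn_expPos_mul]
  simp only [fn_smul_right, fn_add_right, fn_dFn]
  ring

/-- The differential of a function for `[ , ]^φ` is `e^{-t}` times the one for `[ , ]~φ`. -/
lemma expPos_smul_hat_dFn (f : Fn (I.prod 𝓘(ℝ, ℝ)) (M × ℝ)) :
    expPos (I := I) (M := M) • P.tilde.dFn (𝒜.hat P φ) 0 f = P.tilde.dFn (𝒜.tilde P φ) 0 f := by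
  refine P.tilde.sec_ext fun Y => ?_
  rw [fn_smul_right, fn_dFn, fn_dFn, fn_zero_right, zero_mul, add_zero, add_zero,
    ← SkewAlgebroid.act_smul_left, hat_act_expPos_smul]

lemma slice_hat_dFn (f : Fn (I.prod 𝓘(ℝ, ℝ)) (M × ℝ)) (t : ℝ) :
    slice (P.tilde.dFn (𝒜.hat P φ) 0 (expPos * f)) t =
      P.dFn 𝒜 φ (sliceFn f t) + sliceFn (dtFn f) t • φ := by
  have h := P.slice_tilde_dFn 𝒜 φ f t
  rw [← expPos_smul_hat_dFn] at h
  ext x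
  exact smul_right_injective _ (Real.exp_ne_zero t) (congrArg (fun S : Sec I F' V' => S x) h)

end DualPair

/-! ### The two Courant brackets -/

/-- The time-dependent section `X + e^t α` attached to `X + α`. -/
def expSec (e : Sec (I.prod 𝓘(ℝ, ℝ)) F (Tilde V) × Sec (I.prod 𝓘(ℝ, ℝ)) F' (Tilde V')) :
    Sec (I.prod 𝓘(ℝ, ℝ)) F (Tilde V) × Sec (I.prod 𝓘(ℝ, ℝ)) F' (Tilde V') :=
  (e.1, expPos (I := I) (M := M) • e.2)

namespace DualPair

variable (P : DualPair I F V F' V') (𝒜 : SkewAlgebroid I F V) (ℬ : SkewAlgebroid I F' V')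
  (φ : Sec I F' V') (W : Sec I F V)
  {e₁ e₂ : Sec (I.prod 𝓘(ℝ, ℝ)) F (Tilde V) × Sec (I.prod 𝓘(ℝ, ℝ)) F' (Tilde V')}

lemma formMinus_expSec :
    P.tilde.formMinus (expSec e₁) (expSec e₂) = expPos * P.tilde.formMinus e₁ e₂ := by
  have h : P.tilde.formMinus (expSec e₁) (expSec e₂) = (1 / 2 : ℝ) •
      (P.tilde.fn e₂.1 (expPos (I := I) (M := M) • e₁.2) -
        P.tilde.fn e₁.1 (expPos (I := I) (M := M) • e₂.2)) := rfl
  rw [h, fn_smul_right, fn_smul_right, ← mul_sub, ← mul_smul_comm]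
  rfl

/-- On sections whose values pair to zero, `( , )₋` is simply `⟨α₁, X₂⟩`. -/
lemma formMinus_eq (h : P.tilde.fn e₂.1 e₁.2 + P.tilde.fn e₁.1 e₂.2 = 0) :
    P.tilde.formMinus e₁ e₂ = P.tilde.fn e₂.1 e₁.2 := by
  rw [formMinus, eq_neg_of_add_eq_zero_right h, sub_neg_eq_add, ← two_smul ℝ, smul_smul]
  norm_num

lemma sliceFn_dtFn_fn (X : Sec (I.prod 𝓘(ℝ, ℝ)) F (Tilde V))
    (α : Sec (I.prod 𝓘(ℝ, ℝ)) F' (Tilde V')) (t : ℝ) :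
    sliceFn (dtFn (P.tilde.fn X α)) t =
      P.fn (slice (P.dt X) t) (slice α t) + P.fn (slice X t) (slice (P.swap.dt α) t) := by
  rw [dtFn_fn]
  rfl

/-- The function `⟨φ, X⟩ + ⟨α, W⟩`: the pairing of `X + α` with `φ + W`. -/
def cocycleFn (e : Sec I F V × Sec I F' V') : Fn I M := P.fn e.1 φ + P.fn W e.2

/-- The `V`-component of the bracket over `M × ℝ`, at time `t`. The bracket also contains a
multiple of `W`, whose coefficient vanishes because the sections and their time derivatives pair
to zero. -/
lemma slice_courantBracket_fst
    (h₀ : P.tilde.fn e₂.1 e₁.2 + P.tilde.fn e₁.1 e₂.2 = 0) (t : ℝ)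
    (h₂ : P.fn (slice (P.dt e₂.1) t) (slice e₁.2 t) +
      P.fn (slice e₁.1 t) (slice (P.swap.dt e₂.2) t) = 0) :
    slice (P.tilde.courantBracket (𝒜.tilde P φ) (ℬ.hat P.swap W) 0 0 (expSec e₁) (expSec e₂)).1 t =
      (P.courantBracket 𝒜 ℬ φ W (slice e₁.1 t, slice e₁.2 t) (slice e₂.1 t, slice e₂.2 t)).1 +
      P.cocycleFn φ W (slice e₁.1 t, slice e₁.2 t) • slice (P.dt e₂.1) t -
      P.cocycleFn φ W (slice e₂.1 t, slice e₂.2 t) • slice (P.dt e₁.1) t := by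
  have hm := P.sliceFn_dtFn_fn e₂.1 e₁.2 t
  rw [← P.formMinus_eq h₀] at hm
  have e0 : slice (P.tilde.courantBracket (𝒜.tilde P φ) (ℬ.hat P.swap W) 0 0
      (expSec e₁) (expSec e₂)).1 t =
      slice ((𝒜.tilde P φ).bracket e₁.1 e₂.1) t +
      slice (P.swap.tilde.lie (ℬ.hat P.swap W) 0 (expPos (I := I) (M := M) • e₁.2) e₂.1) t -
      slice (P.swap.tilde.lie (ℬ.hat P.swap W) 0 (expPos (I := I) (M := M) • e₂.2) e₁.1) t -
      slice (P.swap.tilde.dFn (ℬ.hat P.swap W) 0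
        (P.tilde.formMinus (expSec e₁) (expSec e₂))) t := rfl
  rw [e0, formMinus_expSec, slice_tilde_bracket, slice_hat_lie, slice_hat_lie, slice_hat_dFn, hm]
  show 𝒜.bracket (slice e₁.1 t) (slice e₂.1 t) + P.fn (slice e₁.1 t) φ • slice (P.dt e₂.1) t -
      P.fn (slice e₂.1 t) φ • slice (P.dt e₁.1) t +
      (P.swap.lie ℬ W (slice e₁.2 t) (slice e₂.1 t) + P.fn W (slice e₁.2 t) • slice (P.dt e₂.1) t +
        P.fn (slice e₂.1 t) (slice (P.swap.dt e₁.2) t) • W) -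
      (P.swap.lie ℬ W (slice e₂.2 t) (slice e₁.1 t) + P.fn W (slice e₂.2 t) • slice (P.dt e₁.1) t +
        P.fn (slice e₁.1 t) (slice (P.swap.dt e₂.2) t) • W) -
      (P.swap.dFn ℬ W (P.formMinus (slice e₁.1 t, slice e₁.2 t) (slice e₂.1 t, slice e₂.2 t)) +
        (P.fn (slice (P.dt e₂.1) t) (slice e₁.2 t) +
          P.fn (slice e₂.1 t) (slice (P.swap.dt e₁.2) t)) • W) =
    𝒜.bracket (slice e₁.1 t) (slice e₂.1 t) + P.swap.lie ℬ W (slice e₁.2 t) (slice e₂.1 t) -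
      P.swap.lie ℬ W (slice e₂.2 t) (slice e₁.1 t) -
      P.swap.dFn ℬ W (P.formMinus (slice e₁.1 t, slice e₁.2 t) (slice e₂.1 t, slice e₂.2 t)) +
      (P.fn (slice e₁.1 t) φ + P.fn W (slice e₁.2 t)) • slice (P.dt e₂.1) t -
      (P.fn (slice e₂.1 t) φ + P.fn W (slice e₂.2 t)) • slice (P.dt e₁.1) t
  rw [eq_neg_of_add_eq_zero_right h₂]
  module

/-- The `V'`-component of the bracket over `M × ℝ`, at time `t`. The coefficient of `φ` vanishes
for the same reason as that of `W` in the `V`-component. -/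
lemma slice_courantBracket_snd
    (h₀ : P.tilde.fn e₂.1 e₁.2 + P.tilde.fn e₁.1 e₂.2 = 0) (t : ℝ)
    (h₁ : P.fn (slice (P.dt e₁.1) t) (slice e₂.2 t) +
      P.fn (slice e₂.1 t) (slice (P.swap.dt e₁.2) t) = 0) :
    slice (P.tilde.courantBracket (𝒜.tilde P φ) (ℬ.hat P.swap W) 0 0 (expSec e₁) (expSec e₂)).2 t =
      sliceFn (expPos (I := I) (M := M)) t •
      ((P.courantBracket 𝒜 ℬ φ W (slice e₁.1 t, slice e₁.2 t) (slice e₂.1 t, slice e₂.2 t)).2 +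
      P.cocycleFn φ W (slice e₁.1 t, slice e₁.2 t) • slice (P.swap.dt e₂.2) t -
      P.cocycleFn φ W (slice e₂.1 t, slice e₂.2 t) • slice (P.swap.dt e₁.2) t) := by
  have hm := P.sliceFn_dtFn_fn e₂.1 e₁.2 t
  rw [← P.formMinus_eq h₀] at hm
  have hb : slice ((ℬ.hat P.swap W).bracket (expPos (I := I) (M := M) • e₁.2)
      (expPos (I := I) (M := M) • e₂.2)) t = sliceFn (expPos (I := I) (M := M)) t •
      (ℬ.bracket (slice e₁.2 t) (slice e₂.2 t) +
        P.fn W (slice e₁.2 t) • slice (P.swap.dt e₂.2) t -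
        P.fn W (slice e₂.2 t) • slice (P.swap.dt e₁.2) t) := by
    have h : ℬ.bracket (slice e₁.2 t) (Real.exp t • slice e₂.2 t) =
        sliceFn (expPos (I := I) (M := M)) t • ℬ.bracket (slice e₁.2 t) (slice e₂.2 t) :=
      ℬ.bracket_smul _ _ _
    have h' : P.fn W (sliceFn (expPos (I := I) (M := M)) t • slice e₂.2 t) =
        sliceFn (expPos (I := I) (M := M)) t * P.fn W (slice e₂.2 t) := P.fn_smul_right _ _ _
    rw [slice_hat_bracket_expPos_smul, dt_expPos_smul]
    show ℬ.bracket (slice e₁.2 t) (Real.exp t • slice e₂.2 t) + P.fn W (slice e₁.2 t) •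
      (sliceFn (expPos (I := I) (M := M)) t • (slice (P.swap.dt e₂.2) t + slice e₂.2 t) -
        sliceFn (expPos (I := I) (M := M)) t • slice e₂.2 t) -
      P.fn W (sliceFn (expPos (I := I) (M := M)) t • slice e₂.2 t) • slice (P.swap.dt e₁.2) t = _
    rw [h, h']
    module
  have e0 : slice (P.tilde.courantBracket (𝒜.tilde P φ) (ℬ.hat P.swap W) 0 0
      (expSec e₁) (expSec e₂)).2 t =
      slice ((ℬ.hat P.swap W).bracket (expPos (I := I) (M := M) • e₁.2)
        (expPos (I := I) (M := M) • e₂.2)) t +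
      slice (P.tilde.lie (𝒜.tilde P φ) 0 e₁.1 (expPos (I := I) (M := M) • e₂.2)) t -
      slice (P.tilde.lie (𝒜.tilde P φ) 0 e₂.1 (expPos (I := I) (M := M) • e₁.2)) t +
      slice (P.tilde.dFn (𝒜.tilde P φ) 0
        (P.tilde.formMinus (expSec e₁) (expSec e₂))) t := rfl
  rw [e0, hb, formMinus_expSec, slice_tilde_lie, slice_tilde_lie, slice_tilde_dFn, hm,
    eq_neg_of_add_eq_zero_right h₁]
  show _ = sliceFn (expPos (I := I) (M := M)) t •
    (ℬ.bracket (slice e₁.2 t) (slice e₂.2 t) + P.lie 𝒜 φ (slice e₁.1 t) (slice e₂.2 t) -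
      P.lie 𝒜 φ (slice e₂.1 t) (slice e₁.2 t) +
      P.dFn 𝒜 φ (P.formMinus (slice e₁.1 t, slice e₁.2 t) (slice e₂.1 t, slice e₂.2 t)) +
      (P.fn (slice e₁.1 t) φ + P.fn W (slice e₁.2 t)) • slice (P.swap.dt e₂.2) t -
      (P.fn (slice e₂.1 t) φ + P.fn W (slice e₂.2 t)) • slice (P.swap.dt e₁.2) t)
  have hf : sliceFn (P.tilde.formMinus e₁ e₂) t =
    P.formMinus (slice e₁.1 t, slice e₁.2 t) (slice e₂.1 t, slice e₂.2 t) := rfl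
  rw [hf]
  module

/-! ### Dirac structures -/

lemma exists_expSec_eq
    (e : Sec (I.prod 𝓘(ℝ, ℝ)) F (Tilde V) × Sec (I.prod 𝓘(ℝ, ℝ)) F' (Tilde V')) :
    ∃ e', e = expSec e' :=
  ⟨(e.1, SkewAlgebroid.expNeg (I := I) (M := M) • e.2),
    Prod.ext rfl (expPos_expNeg_smul e.2).symm⟩

/-- Sections of `{X + e^t α : X + α ∈ L}` are the time-dependent sections of `L`, with `α` rescaled. -/
lemma isSection_expSec (L : ∀ x, Submodule ℝ (V x × V' x))
    (e : Sec (I.prod 𝓘(ℝ, ℝ)) F (Tilde V) × Sec (I.prod 𝓘(ℝ, ℝ)) F' (Tilde V')) :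
    IsSection (expand L) (expSec e) ↔ ∀ t, IsSection L (slice e.1 t, slice e.2 t) :=
  ⟨fun h t x => (expMap_mem_expand L (x, t) (e.1 (x, t), e.2 (x, t))).1 (h (x, t)),
    fun h p => (expMap_mem_expand L p (e.1 p, e.2 p)).2 (h p.2 p.1)⟩

variable {L : ∀ x, Submodule ℝ (V x × V' x)}

lemma fn_add_fn_eq_zero (hL : ∀ x, P.IsIsotropic x (L x)) {e e' : Sec I F V × Sec I F' V'}
    (he : IsSection L e) (he' : IsSection L e') : P.fn e.1 e'.2 + P.fn e'.1 e.2 = 0 := by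
  ext x
  have h : 1 / 2 * (P.pair x (e.1 x) (e'.2 x) + P.pair x (e'.1 x) (e.2 x)) = 0 :=
    hL x _ (he' x) _ (he x)
  show P.pair x (e.1 x) (e'.2 x) + P.pair x (e'.1 x) (e.2 x) = 0
  linarith

/-- For isotropic `L` the bracket over `M × ℝ` of sections `X₁ + e^t α₁` and `X₂ + e^t α₂` differs
from the bracket over `M` of their slices by multiples of time derivatives, which lie in `L`. -/
lemma isSection_courantBracket_expSec (hL : ∀ x, P.IsIsotropic x (L x))
    (he₁ : ∀ t, IsSection L (slice e₁.1 t, slice e₁.2 t))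
    (he₂ : ∀ t, IsSection L (slice e₂.1 t, slice e₂.2 t)) (x : M) (t : ℝ) :
    (((P.tilde.courantBracket (𝒜.tilde P φ) (ℬ.hat P.swap W) 0 0 (expSec e₁) (expSec e₂)).1 (x, t),
      (P.tilde.courantBracket (𝒜.tilde P φ) (ℬ.hat P.swap W) 0 0 (expSec e₁) (expSec e₂)).2 (x, t)) :
        V x × V' x) ∈ expand L (x, t) ↔
    ((P.courantBracket 𝒜 ℬ φ W (slice e₁.1 t, slice e₁.2 t) (slice e₂.1 t, slice e₂.2 t)).1 x,
      (P.courantBracket 𝒜 ℬ φ W (slice e₁.1 t, slice e₁.2 t) (slice e₂.1 t, slice e₂.2 t)).2 x) ∈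
        L x := by
  have hd₁ : IsSection L (slice (P.dt e₁.1) t, slice (P.swap.dt e₁.2) t) := fun y =>
    P.dt_mem e₁.1 e₁.2 (y, t) (L y) fun s => he₁ s y
  have hd₂ : IsSection L (slice (P.dt e₂.1) t, slice (P.swap.dt e₂.2) t) := fun y =>
    P.dt_mem e₂.1 e₂.2 (y, t) (L y) fun s => he₂ s y
  have h₀ : P.tilde.fn e₂.1 e₁.2 + P.tilde.fn e₁.1 e₂.2 = 0 := ContMDiffMap.ext fun p =>
    congrArg (fun f : Fn I M => f p.1) (P.fn_add_fn_eq_zero hL (he₂ p.2) (he₁ p.2))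
  have h₁ := P.fn_add_fn_eq_zero hL hd₁ (he₂ t)
  have h₂ := P.fn_add_fn_eq_zero hL hd₂ (he₁ t)
  have hf := congrArg (fun S : Sec I F V => S x)
    (P.slice_courantBracket_fst 𝒜 ℬ φ W h₀ t h₂)
  have hs := congrArg (fun S : Sec I F' V' => S x)
    (P.slice_courantBracket_snd 𝒜 ℬ φ W h₀ t h₁)
  set C := P.courantBracket 𝒜 ℬ φ W (slice e₁.1 t, slice e₁.2 t) (slice e₂.1 t, slice e₂.2 t)
  set c₁ := P.cocycleFn φ W (slice e₁.1 t, slice e₁.2 t)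
  set c₂ := P.cocycleFn φ W (slice e₂.1 t, slice e₂.2 t)
  have key := expMap_mem_expand L (x, t) (((C.1 x, C.2 x) : V x × V' x) +
    c₁ x • (slice (P.dt e₂.1) t x, slice (P.swap.dt e₂.2) t x) -
    c₂ x • (slice (P.dt e₁.1) t x, slice (P.swap.dt e₁.2) t x))
  rw [Submodule.sub_mem_iff_left _ ((L x).smul_mem _ (hd₁ x)),
    Submodule.add_mem_iff_left _ ((L x).smul_mem _ (hd₂ x))] at key
  refine Iff.trans (iff_of_eq (congrArg (· ∈ expand L (x, t)) ?_)) key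
  exact Prod.ext hf hs

/-- `L` is a Dirac structure over `M` exactly when `{X + e^t α : X + α ∈ L}` is one over `M × ℝ`. -/
theorem isDirac_iff_expand (hL : IsSubbundle I F V F' V' L) :
    P.IsDirac 𝒜 ℬ φ W L ↔
      P.tilde.IsDirac (𝒜.tilde P φ) (ℬ.hat P.swap W) 0 0 (expand L) := by
  constructor
  · intro h
    refine ⟨hL.expand, fun p => (P.isIsotropic_map_expMap p.2).2 (h.isotropic p.1),
      fun p => (P.maximal_map_expMap p.2).2 (h.maximal p.1), fun e₁ e₂ he₁ he₂ => ?_⟩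
    obtain ⟨e₁, rfl⟩ := exists_expSec_eq e₁
    obtain ⟨e₂, rfl⟩ := exists_expSec_eq e₂
    have he₁ := (isSection_expSec L e₁).1 he₁
    have he₂ := (isSection_expSec L e₂).1 he₂
    exact fun p => (P.isSection_courantBracket_expSec 𝒜 ℬ φ W h.isotropic he₁ he₂ p.1 p.2).2
      (h.integrable _ _ (he₁ p.2) (he₂ p.2) p.1)
  · intro h
    have hiso : ∀ x, P.IsIsotropic x (L x) := fun x =>
      (P.isIsotropic_map_expMap 0).1 (h.isotropic (x, 0))
    refine ⟨hL, hiso, fun x => (P.maximal_map_expMap 0).1 (h.maximal (x, 0)),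
      fun e₁ e₂ he₁ he₂ x => ?_⟩
    have h₁ : ∀ t, IsSection L (slice (pull e₁.1) t, slice (pull e₁.2) t) := fun _ => he₁
    have h₂ : ∀ t, IsSection L (slice (pull e₂.1) t, slice (pull e₂.2) t) := fun _ => he₂
    exact (P.isSection_courantBracket_expSec 𝒜 ℬ φ W (e₁ := (pull e₁.1, pull e₁.2))
      (e₂ := (pull e₂.1, pull e₂.2)) hiso h₁ h₂ x 0).1
      (h.integrable _ _ ((isSection_expSec L _).2 h₁) ((isSection_expSec L _).2 h₂) (x, 0))

end DualPair

end TimeDependent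

end DiracCourant

end

theorem mainTheorem1
    {E : Type*} [NormedAddCommGroup E] [NormedSpace ℝ E] [FiniteDimensional ℝ E]
    {H : Type*} [TopologicalSpace H] (I : ModelWithCorners ℝ E H)
    {M : Type*} [TopologicalSpace M] [ChartedSpace H M] [IsManifold I ∞ M]
    [BoundarylessManifold I M] [T2Space M]
    (F : Type*) [NormedAddCommGroup F] [NormedSpace ℝ F] [FiniteDimensional ℝ F]
    (A : M → Type*) [TopologicalSpace (TotalSpace F A)] [∀ x, AddCommGroup (A x)]
    [∀ x, Module ℝ (A x)] [∀ x, TopologicalSpace (A x)] [FiberBundle F A] [VectorBundle ℝ F A]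
    [ContMDiffVectorBundle ∞ F A I]
    (𝒜 : DiracCourant.LieAlgebroid I F A)
    (ℬ : DiracCourant.LieAlgebroid I (F →L[ℝ] ℝ) (DiracCourant.DualBundle A))
    (φ : DiracCourant.Sec I (F →L[ℝ] ℝ) (DiracCourant.DualBundle A))
    (W : DiracCourant.Sec I F A)
    (hbi : (DiracCourant.canon I F A).IsGenLieBialgebroid
      𝒜.toSkewAlgebroid ℬ.toSkewAlgebroid φ W)
    (L : ∀ x, Submodule ℝ (A x × DiracCourant.DualBundle A x))
    (hL : DiracCourant.DualPair.IsSubbundle I F A (F →L[ℝ] ℝ) (DiracCourant.DualBundle A) L) :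
    (DiracCourant.canon I F A).IsDirac 𝒜.toSkewAlgebroid ℬ.toSkewAlgebroid φ W L ↔
      (DiracCourant.canon I F A).tilde.IsDirac
        (𝒜.toSkewAlgebroid.tilde (DiracCourant.canon I F A) φ)
        (ℬ.toSkewAlgebroid.hat (DiracCourant.canon I F A).swap W)
        0 0 (DiracCourant.expand L) := by
  exact (DiracCourant.canon I F A).isDirac_iff_expand 𝒜.toSkewAlgebroid ℬ.toSkewAlgebroid φ W hL
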